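/- Let $\mathbb T=\mathbb R\cup\{-\infty\}$ be the max-plus semiring (operations $\vee=\max$ and $+$), with its usual topology, and let $A\in\mathbb T^{n\times n}$. Powers of $A$ are taken for the product $(AB)_{ij}=\bigvee_k(A_{ik}+B_{kj})$. *Ultimate rank.* Two matrices are (projectively) equivalent if they differ by a finite additive constant; $\pi$ denotes the quotient map. The set of classes carries the quotient topology on classes of non-null matrices, the class of the null matrix $(-\infty)$ being an isolated point. Let $\mathrm{rk}_\star$ be any one of the following ranks of a tropical matrix: the tropical rank (largest size of a submatrix that is non-singular, i.e. whose permanent is reached by only one permutation and which is not the $1\times1$ matrix $(-\infty)$); the symmetrized rank (largest size of a submatrix for which the maximum weight of the even permutations differs from that of the odd ones); the Gondran–Minoux row or column rank (largest number of rows, resp. columns, $x_1,\dots,x_r$ such that $\bigvee_{i\in I}(\alpha_i+x_i)\ne\bigvee_{j\in J}(\alpha_j+x_j)$ for all disjoint $I,J$ and all scalars $\alpha_i\in\mathbb T$, $i\in I\cup J$, not all $-\infty$); the Kapranov rank (least dimension of a tropical linear space containing the columns, a tropical linear space of dimension $d$ being the image, under the coordinatewise valuation, of a $d$-dimensional linear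 subspace over the field of generalized Puiseux series with complex coefficients and real exponents, where the valuation is minus the order, and $-\infty$ at $0$); the Schein/Barvinok rank (least $r$ such that the matrix is a product of an $n\times r$ and an $r\times m$ matrix); the row or column rank (number of elements of a minimal generating set of the tropical convex hull, i.e. the set of max-plus linear combinations, of the rows, resp. columns). The *ultimate rank* of $A$ is $$\mathrm{urk}(A)=\min\{\mathrm{rk}_\star(B) : \pi(B)\in\overline{\{\pi(A^k):k\in\mathbb N\}}\}.$$ *Critical graph.* Let $\mathcal G(A)$ be the directed graph on $\{1,\dots,n\}$ with an arc $(i,j)$ of weight $A_{ij}$ whenever $A_{ij}\ne-\infty$. Let $$\rho(A)=\bigvee_{1\le j\le n}\ \bigvee_{i_1,\dots,i_j}\frac{A_{i_1i_2}+A_{i_2i_3}+\cdots+A_{i_ji_1}}{j}$$ be the maximal mean weight of its circuits ($-\infty$ if there are none), and let $\mathcal G_c(A)$, the critical graph, be the union of all circuits of $\mathcal G(A)$ of positive length with mean weight $\rho(A)$. Let $\mathrm{per}(A)=\bigvee_{\sigma\in\mathfrak S_n}\sum_i A_{i\sigma(i)}$ be the tropical permanent. Then, for each of the above choices of $\mathrm{rk}_\star$,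 the following statements are equivalent: 1. $\mathrm{urk}(A)=n$; 2. $\mathcal G_c(A)$ is a disjoint union of simple circuits covering all the nodes $\{1,\dots,n\}$; 3. exactly one permutation $\tau\in\mathfrak S_n$ reaches the maximum in $\mathrm{per}(A)$, and $\mathcal G_c(A)$ is the graph of $\tau$, that is, the graph with nodes $\{1,\dots,n\}$ and arcs $(i,\tau(i))$. Furthermore, if these statements hold, then $\mathrm{per}(A)=n\rho(A)$. -/

import Mathlib

noncomputable section

namespace Tropical53

/-- The max-plus semiring `ℝ ∪ {-∞}`: its "addition" is `⊔`, its "multiplication" is `+`,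
and `-∞` is `⊥`, with `⊥ + x = ⊥`. -/
abbrev T : Type := WithBot ℝ

/-- Square or rectangular matrices over the max-plus semiring. The operations `*`, `^` that Mathlib
attaches to matrices are never used for them. -/
abbrev TMat (n m : ℕ) : Type := Matrix (Fin n) (Fin m) T

/-- The null matrix, with all entries `-∞`. -/
def nullMat (n m : ℕ) : TMat n m := fun _ _ => ⊥

/-- The max-plus product of matrices. -/
def tmul {n m p : ℕ} (A : TMat n m) (B : TMat m p) : TMat n p :=
  fun i j => Finset.univ.sup fun k => A i k + B k j

/-- The max-plus identity matrix. -/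
def tone (n : ℕ) : TMat n n := fun i j => if i = j then 0 else ⊥

/-- The max-plus powers of a square matrix. -/
def tpow {n : ℕ} (A : TMat n n) : ℕ → TMat n n
  | 0 => tone n
  | k + 1 => tmul (tpow A k) A

/-- The action of a real scalar on a matrix. -/
def smulMat {n m : ℕ} (c : ℝ) (A : TMat n m) : TMat n m := fun i j => (c : T) + A i j

/-! ### The projective space of matrices and its topology -/

/-- Tropical equivalence of matrices: equality up to a finite scalar. -/
def projSetoid (n m : ℕ) : Setoid (TMat n m) where
  r A B := ∃ c : ℝ, B = smulMat c A
  iseqv :=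
    { refl := fun A => ⟨0, by funext i j; simp [smulMat]⟩
      symm := by
        rintro A B ⟨c, rfl⟩
        refine ⟨-c, ?_⟩
        funext i j
        simp only [smulMat]
        rw [← add_assoc, ← WithBot.coe_add]
        simp
      trans := by
        rintro A B C ⟨c, rfl⟩ ⟨d, rfl⟩
        refine ⟨d + c, ?_⟩
        funext i j
        simp only [smulMat]
        rw [← add_assoc, ← WithBot.coe_add] }

/-- The projective matrix set. -/
def ProjMat (n m : ℕ) : Type := Quotient (projSetoid n m)

/-- The quotient map. -/
def proj {n m : ℕ} (A : TMat n m) : ProjMat n m := Quotient.mk (projSetoid n m) A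

/-- The usual topology of `ℝ ∪ {-∞}` (the order topology, homeomorphic to `[0, ∞)` by `exp`). -/
abbrev topT : TopologicalSpace T := Preorder.topology T

/-- The entrywise (product) topology on matrices. -/
abbrev topMat (n m : ℕ) : TopologicalSpace (TMat n m) :=
  @Pi.topologicalSpace (Fin n) (fun _ => Fin m → T)
    fun _ => @Pi.topologicalSpace (Fin m) (fun _ => T) fun _ => topT

/-- The topology of the projective matrix set: the quotient topology on the classes of non-null
matrices, the class of the null matrix being an isolated point. (In the quotient of the whole space
of matrices the null class would belong to every non-empty closed set.) -/
instance (n m : ℕ) : TopologicalSpace (ProjMat n m) :=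
  TopologicalSpace.coinduced (fun A : {A : TMat n m // A ≠ nullMat n m} => proj A.1)
    (TopologicalSpace.induced Subtype.val (topMat n m))

/-- The closure of the projective semigroup generated by `A`. -/
def closProj {n : ℕ} (A : TMat n n) : Set (ProjMat n n) :=
  closure (Set.range fun k : ℕ => proj (tpow A k))

/-! ### Permanent, non-singularity, and the ranks of a matrix -/

/-- The weight of a permutation. -/
def permWeight {n : ℕ} (A : TMat n n) (σ : Equiv.Perm (Fin n)) : T := ∑ i, A i (σ i)

/-- The tropical permanent. -/
def per {n : ℕ} (A : TMat n n) : T := Finset.univ.sup fun σ => permWeight A σ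

/-- Non-singular: two different permutations never both reach the permanent, and a matrix of
size one is not `(-∞)`. -/
def Nonsingular {n : ℕ} (A : TMat n n) : Prop :=
  ¬ ((n = 1 ∧ A = nullMat n n) ∨
    ∃ σ τ : Equiv.Perm (Fin n), σ ≠ τ ∧ permWeight A σ = per A ∧ permWeight A τ = per A)

/-- The maximum of the weights of the even permutations. -/
def detPlus {n : ℕ} (A : TMat n n) : T :=
  (Finset.univ.filter fun σ : Equiv.Perm (Fin n) => Equiv.Perm.sign σ = 1).sup
    fun σ => permWeight A σ

/-- The maximum of the weights of the odd permutations (`-∞` if there are none). -/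
def detMinus {n : ℕ} (A : TMat n n) : T :=
  (Finset.univ.filter fun σ : Equiv.Perm (Fin n) => Equiv.Perm.sign σ = -1).sup
    fun σ => permWeight A σ

/-- The tropical rank: the largest size of a non-singular submatrix. -/
def tropicalRank {n m : ℕ} (A : TMat n m) : ℕ :=
  sSup {r | ∃ (f : Fin r ↪o Fin n) (g : Fin r ↪o Fin m), Nonsingular (A.submatrix f g)}

/-- The symmetrized rank: the largest size of a submatrix whose two determinants differ. -/
def symmetrizedRank {n m : ℕ} (A : TMat n m) : ℕ :=
  sSup {r | ∃ (f : Fin r ↪o Fin n) (g : Fin r ↪o Fin m),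
    detPlus (A.submatrix f g) ≠ detMinus (A.submatrix f g)}

/-- The product of a vector by a scalar of the max-plus semiring. -/
def smulVec {m : ℕ} (a : T) (x : Fin m → T) : Fin m → T := fun j => a + x j

/-- Linear independence of a family of vectors in the sense of Gondran and Minoux. -/
def GMIndependent {r m : ℕ} (x : Fin r → Fin m → T) : Prop :=
  ∀ (I J : Finset (Fin r)) (a : Fin r → T), Disjoint I J → (∃ i ∈ I ∪ J, a i ≠ ⊥) →
    (I.sup fun i => smulVec (a i) (x i)) ≠ J.sup fun j => smulVec (a j) (x j)

/-- The Gondran-Minoux row rank: the largest number of independent rows. -/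
def gmRowRank {n m : ℕ} (A : TMat n m) : ℕ :=
  sSup {r | ∃ f : Fin r ↪o Fin n, GMIndependent fun i => A (f i)}

/-- The Gondran-Minoux column rank. -/
def gmColRank {n m : ℕ} (A : TMat n m) : ℕ := gmRowRank A.transpose

/-- The field of generalized Puiseux series with complex coefficients and real exponents. -/
abbrev K : Type := HahnSeries ℝ ℂ

open Classical in
/-- The valuation in the max convention: minus the order, and `-∞` at `0`. -/
def val (x : K) : T := if x = 0 then ⊥ else ((-x.order : ℝ) : T)

/-- The tropical linear space of a linear subspace: the set of valuations of its vectors. -/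
def tropLinear {n : ℕ} (W : Submodule K (Fin n → K)) : Set (Fin n → T) :=
  (fun (x : Fin n → K) (i : Fin n) => val (x i)) '' (W : Set (Fin n → K))

/-- The Kapranov rank: the least dimension of a tropical linear space containing the columns. -/
def kapranovRank {n m : ℕ} (A : TMat n m) : ℕ :=
  sInf {d | ∃ W : Submodule K (Fin n → K),
    Module.finrank K W = d ∧ ∀ j, A.transpose j ∈ tropLinear W}

/-- The Schein (or Barvinok, or factor) rank. -/
def scheinRank {n m : ℕ} (A : TMat n m) : ℕ :=
  sInf {r | ∃ (B : TMat n r) (C : TMat r m), A = tmul B C}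

/-- The tropical convex hull of a finite family of vectors (all its max-plus combinations). -/
def tropHull {ι : Type} [Fintype ι] {m : ℕ} (x : ι → Fin m → T) : Set (Fin m → T) :=
  {y | ∃ a : ι → T, y = Finset.univ.sup fun i => smulVec (a i) (x i)}

/-- The finite set `G` of vectors generates `X` as a tropically convex set. -/
def Generates {m : ℕ} (X : Set (Fin m → T)) (G : Finset (Fin m → T)) : Prop :=
  tropHull (fun s : {s // s ∈ G} => s.1) = X

/-- The weak dimension of a finitely generated tropically convex set: the cardinality of a
generating set that is minimal for inclusion. (All of them have the same cardinality.) -/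
def weakDim {m : ℕ} (X : Set (Fin m → T)) : ℕ :=
  sInf {k | ∃ G : Finset (Fin m → T), Minimal (Generates X) G ∧ G.card = k}

/-- The row rank: the weak dimension of the convex hull of the rows. -/
def rowRank {n m : ℕ} (A : TMat n m) : ℕ := weakDim (tropHull fun i : Fin n => A i)

/-- The column rank. -/
def colRank {n m : ℕ} (A : TMat n m) : ℕ := rowRank A.transpose

/-- The notions of rank of a tropical matrix. -/
inductive RankNotion : Type
  | tropical
  | symmetrized
  | gondranMinouxRow
  | gondranMinouxColumn
  | kapranov
  | schein
  | row
  | column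

/-- The rank of a matrix for a given notion of rank. -/
def rk {n m : ℕ} : RankNotion → TMat n m → ℕ
  | .tropical, A => tropicalRank A
  | .symmetrized, A => symmetrizedRank A
  | .gondranMinouxRow, A => gmRowRank A
  | .gondranMinouxColumn, A => gmColRank A
  | .kapranov, A => kapranovRank A
  | .schein, A => scheinRank A
  | .row, A => rowRank A
  | .column, A => colRank A

/-- The ultimate rank of `A` for a given notion of rank: the minimal rank over the closure of the
projective semigroup generated by `A`. -/
def urk {n : ℕ} (s : RankNotion) (A : TMat n n) : ℕ :=
  sInf {r | ∃ B : TMat n n, proj B ∈ closProj A ∧ rk s B = r}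

/-! ### Circuits and the critical graph -/

/-- A closed sequence of nodes `node 0, …, node ℓ, node 0`, of length `ℓ + 1`. Indices are taken
in `Fin (ℓ + 1)`, where the successor of the last one is `0`. -/
structure ClosedSeq (n : ℕ) : Type where
  ℓ : ℕ
  node : Fin (ℓ + 1) → Fin n

/-- The arcs of the closed sequence all belong to the graph of `A`: it is a circuit of this
graph. -/
def IsCircuit {n : ℕ} (A : TMat n n) (c : ClosedSeq n) : Prop :=
  ∀ t, A (c.node t) (c.node (t + 1)) ≠ ⊥

/-- Each node is visited at most once (apart from the return to the first one). -/
def ClosedSeq.IsSimple {n : ℕ} (c : ClosedSeq n) : Prop := Function.Injective c.node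

/-- The mean weight. -/
def meanWeight {n : ℕ} (A : TMat n n) (c : ClosedSeq n) : T :=
  WithBot.map (fun w : ℝ => w / ((c.ℓ : ℝ) + 1)) (∑ t, A (c.node t) (c.node (t + 1)))

/-- `ρ(A)`: the maximum of the mean weights over the closed sequences of length at most `n`. -/
def rho {n : ℕ} (A : TMat n n) : T :=
  Finset.univ.sup fun l : Fin n =>
    Finset.univ.sup fun x : Fin (l.1 + 1) → Fin n => meanWeight A ⟨l.1, x⟩

/-- A directed graph whose nodes form a subset of `{1, …, n}`. -/
@[ext]
structure DGraph (n : ℕ) : Type where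
  nodes : Set (Fin n)
  arcs : Set (Fin n × Fin n)
  mem_of_arc : ∀ a ∈ arcs, a.1 ∈ nodes ∧ a.2 ∈ nodes

/-- The graph formed by the nodes and the arcs of a closed sequence. -/
def ClosedSeq.graph {n : ℕ} (c : ClosedSeq n) : DGraph n where
  nodes := Set.range c.node
  arcs := Set.range fun t => (c.node t, c.node (t + 1))
  mem_of_arc := by
    rintro _ ⟨t, rfl⟩
    exact ⟨⟨t, rfl⟩, ⟨t + 1, rfl⟩⟩

/-- The union of the graphs of a set of closed sequences. -/
def unionGraph {n : ℕ} (S : Set (ClosedSeq n)) : DGraph n where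
  nodes := ⋃ c ∈ S, c.graph.nodes
  arcs := ⋃ c ∈ S, c.graph.arcs
  mem_of_arc := by
    intro a ha
    simp only [Set.mem_iUnion] at ha ⊢
    obtain ⟨c, hc, ha⟩ := ha
    have h := c.graph.mem_of_arc a ha
    exact ⟨⟨c, hc, h.1⟩, ⟨c, hc, h.2⟩⟩

/-- A critical circuit. -/
def IsCritical {n : ℕ} (A : TMat n n) (c : ClosedSeq n) : Prop :=
  IsCircuit A c ∧ meanWeight A c = rho A

/-- The critical graph: the union of all critical circuits. -/
def criticalGraph {n : ℕ} (A : TMat n n) : DGraph n := unionGraph {c | IsCritical A c}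

/-- The graph is a union of pairwise (node-)disjoint simple circuits covering all the nodes. -/
def IsDisjointUnionOfSimpleCircuits {n : ℕ} (G : DGraph n) : Prop :=
  ∃ S : Set (ClosedSeq n), (∀ c ∈ S, c.IsSimple) ∧
    S.PairwiseDisjoint (fun c => c.graph.nodes) ∧ G = unionGraph S ∧ G.nodes = Set.univ

/-- The graph of a permutation, with arcs `(i, τ i)`. -/
def permGraph {n : ℕ} (τ : Equiv.Perm (Fin n)) : DGraph n where
  nodes := Set.univ
  arcs := Set.range fun i => (i, τ i)
  mem_of_arc := fun _ _ => ⟨trivial, trivial⟩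

/-- The permutation `τ` is the unique one that reaches the maximum in the permanent. -/
def IsUniqueMaximizer {n : ℕ} (A : TMat n n) (τ : Equiv.Perm (Fin n)) : Prop :=
  ∀ σ : Equiv.Perm (Fin n), permWeight A σ = per A ↔ σ = τ

end Tropical53

end

open Tropical53

noncomputable section

namespace Tropical53

open Finset Filter Topology

/-! ### Powers and walks -/

/-! All three statements amount to: the critical graph is the graph of some permutation `τ`. When
`rho A` is a real `r`, subtracting `r` and conjugating by a potential gives a matrix `A'` with
nonpositive entries (`exists_potential`). The critical arcs are then the arcs of weight `0` lying on
closed walks of weight `0`. Conjugation and scalars affect neither the dependence of rows nor the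
strict optimality of a permutation, so powers of `A'` can replace those of `A`.

If the critical graph is not that of a permutation, the closure contains a matrix with a dependent
row and a dependent column, and every rank of it is less than `n`. Without circuits a power is null.
If a node is not critical, a power `C` of `A'` has loops of weight `0` at all critical nodes; its
powers converge to a matrix generated by its critical rows and by its critical columns. If all nodes
are critical but two critical arcs leave one node, for `j` and `k`, then a stabilized power has
equal rows, and equal columns, `j` and `k`.

Conversely, if the critical graph is that of `τ`, then `τ ^ k` is the strict optimum in the `k`-th
power (`isStrictMax_tpow`): a rival of weight `0` would consist of walks whose arcs are all
critical, hence follow `τ`. The projective powers are finitely many and points are closed, so the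
closure adds nothing. A strict optimum makes every rank full: by exchange along a cycle for
Gondran–Minoux, by a nonzero determinant over Hahn series for Kapranov, and from there for Schein
and row rank through factorizations. The power `k = 1` gives uniqueness and the value of the
permanent. -/

theorem tmul_le_iff {n m p : ℕ} {A : TMat n m} {B : TMat m p} {i : Fin n} {j : Fin p} {x : T} :
    tmul A B i j ≤ x ↔ ∀ k, A i k + B k j ≤ x := by
  simp [tmul]

theorem le_tmul {n m p : ℕ} (A : TMat n m) (B : TMat m p) (i : Fin n) (k : Fin m) (j : Fin p) :
    A i k + B k j ≤ tmul A B i j :=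
  Finset.le_sup (f := fun k => A i k + B k j) (mem_univ k)

/-- An entry of a product other than `-∞` is reached by one of the terms. -/
theorem exists_tmul_eq {n m p : ℕ} {A : TMat n m} {B : TMat m p} {i : Fin n} {j : Fin p}
    (h : tmul A B i j ≠ ⊥) : ∃ k, tmul A B i j = A i k + B k j := by
  have hne : (univ : Finset (Fin m)).Nonempty := by
    rw [nonempty_iff_ne_empty]
    intro h0
    exact h (by simp [tmul, h0])
  obtain ⟨k, -, hk⟩ := exists_mem_eq_sup univ hne fun k => A i k + B k j
  exact ⟨k, hk⟩

theorem tmul_assoc {n m p q : ℕ} (A : TMat n m) (B : TMat m p) (C : TMat p q) :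
    tmul (tmul A B) C = tmul A (tmul B C) := by
  funext i j
  apply le_antisymm
  · rw [tmul_le_iff]
    intro k
    rcases eq_or_ne (tmul A B i k) ⊥ with h | h
    · simp [h]
    obtain ⟨l, hl⟩ := exists_tmul_eq h
    rw [hl, add_assoc]
    exact (add_le_add le_rfl (le_tmul B C l k j)).trans (le_tmul A _ i l j)
  · rw [tmul_le_iff]
    intro k
    rcases eq_or_ne (tmul B C k j) ⊥ with h | h
    · simp [h]
    obtain ⟨l, hl⟩ := exists_tmul_eq h
    rw [hl, ← add_assoc]
    exact (add_le_add (le_tmul A B i k l) le_rfl).trans (le_tmul _ C i l j)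

theorem tmul_tone {n m : ℕ} (A : TMat n m) : tmul A (tone m) = A := by
  funext i j
  apply le_antisymm
  · rw [tmul_le_iff]
    intro k
    rcases eq_or_ne k j with h | h <;> simp [tone, h]
  · simpa [tone] using le_tmul A (tone m) i j j

theorem tone_tmul {n m : ℕ} (A : TMat n m) : tmul (tone n) A = A := by
  funext i j
  apply le_antisymm
  · rw [tmul_le_iff]
    intro k
    rcases eq_or_ne i k with h | h <;> simp [tone, h]
  · simpa [tone] using le_tmul (tone n) A i i j

theorem tpow_add {n : ℕ} (A : TMat n n) (a b : ℕ) :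
    tpow A (a + b) = tmul (tpow A a) (tpow A b) := by
  induction b with
  | zero => simp [tpow, tmul_tone]
  | succ b ih => rw [← add_assoc, tpow, ih, tmul_assoc]; rfl

theorem tpow_one {n : ℕ} (A : TMat n n) : tpow A 1 = A := by
  simp [tpow, tone_tmul]

theorem tpow_mul {n : ℕ} (A : TMat n n) (a b : ℕ) : tpow A (a * b) = tpow (tpow A a) b := by
  induction b with
  | zero => simp [tpow]
  | succ b ih => rw [Nat.mul_succ, tpow_add, ih]; rfl

theorem tpow_zero_diag {n : ℕ} (A : TMat n n) (i : Fin n) : tpow A 0 i i = 0 := by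
  simp [tpow, tone]

theorem le_tpow_add {n : ℕ} (A : TMat n n) (a b : ℕ) (i k j : Fin n) :
    tpow A a i k + tpow A b k j ≤ tpow A (a + b) i j := by
  rw [tpow_add]
  exact le_tmul _ _ _ _ _

theorem tpow_nonpos {n : ℕ} {A : TMat n n} (hA : ∀ i j, A i j ≤ 0) (k : ℕ) (i j : Fin n) :
    tpow A k i j ≤ 0 := by
  induction k generalizing i j with
  | zero => rcases eq_or_ne i j with h | h <;> simp [tpow, tone, h]
  | succ k ih => exact tmul_le_iff.2 fun l => add_nonpos (ih i l) (hA l j)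

/-- The weight of the part of a walk between two times. -/
def walkWeight {n : ℕ} (A : TMat n n) (w : ℕ → Fin n) (a b : ℕ) : T :=
  ∑ t ∈ Ico a b, A (w t) (w (t + 1))

theorem walkWeight_add {n : ℕ} (A : TMat n n) (w : ℕ → Fin n) {a b c : ℕ} (h₁ : a ≤ b)
    (h₂ : b ≤ c) : walkWeight A w a b + walkWeight A w b c = walkWeight A w a c :=
  sum_Ico_consecutive _ h₁ h₂

theorem walkWeight_le_tpow {n : ℕ} (A : TMat n n) (w : ℕ → Fin n) (a k : ℕ) :
    walkWeight A w a (a + k) ≤ tpow A k (w a) (w (a + k)) := by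
  induction k with
  | zero => simp [walkWeight, tpow_zero_diag]
  | succ k ih =>
    rw [← add_assoc, walkWeight, sum_Ico_succ_top (by omega)]
    exact (add_le_add ih le_rfl).trans (le_tmul _ A _ _ _)

theorem walkWeight_le_tpow_sub {n : ℕ} (A : TMat n n) (w : ℕ → Fin n) {a b : ℕ} (h : a ≤ b) :
    walkWeight A w a b ≤ tpow A (b - a) (w a) (w b) := by
  simpa [Nat.add_sub_cancel' h] using walkWeight_le_tpow A w a (b - a)

/-- An entry of a power other than `-∞` is the weight of a walk. -/
theorem exists_walk {n : ℕ} {A : TMat n n} {k : ℕ} {i j : Fin n} (h : tpow A k i j ≠ ⊥) :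
    ∃ w : ℕ → Fin n, w 0 = i ∧ w k = j ∧ walkWeight A w 0 k = tpow A k i j := by
  induction k generalizing j with
  | zero =>
    rcases eq_or_ne i j with rfl | hij
    · exact ⟨fun _ => i, rfl, rfl, by simp [walkWeight, tpow_zero_diag]⟩
    · exact absurd (by simp [tpow, tone, hij]) h
  | succ k ih =>
    obtain ⟨l, hl⟩ := exists_tmul_eq (A := tpow A k) (B := A) h
    have hl' : tpow A (k + 1) i j = tpow A k i l + A l j := hl
    rw [hl', WithBot.add_ne_bot] at h
    obtain ⟨w, hw0, hwk, hw⟩ := ih h.1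
    refine ⟨fun t => if t ≤ k then w t else j, by simp [hw0], by simp, ?_⟩
    rw [walkWeight, sum_Ico_succ_top (by omega), hl', ← hw, walkWeight]
    congr 1
    · refine sum_congr rfl fun t ht => ?_
      rw [mem_Ico] at ht
      rw [if_pos (by omega), if_pos (by omega)]
    · simp [hwk]

/-- Pigeonhole on the `n + 1` times `s, …, s + n`. -/
theorem exists_repeat {n : ℕ} (w : ℕ → Fin n) (s : ℕ) :
    ∃ a b, s ≤ a ∧ a < b ∧ b ≤ s + n ∧ w a = w b := by
  obtain ⟨a, b, hab, h⟩ := Fintype.exists_ne_map_eq_of_card_lt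
    (fun t : Fin (n + 1) => w (s + t)) (by simp)
  have := a.2
  have := b.2
  have hab' : a.1 ≠ b.1 := fun h' => hab (Fin.ext h')
  rcases lt_or_gt_of_ne hab' with h' | h'
  · exact ⟨s + a, s + b, by omega, by omega, by omega, h⟩
  · exact ⟨s + b, s + a, by omega, by omega, by omega, h.symm⟩

/-- Removing a circuit of nonpositive weight from a walk of length `n`. -/
theorem tpow_card_le {n : ℕ} {A : TMat n n}
    (hA : ∀ k, 1 ≤ k → k ≤ n → ∀ i, tpow A k i i ≤ 0) (i j : Fin n) :
    ∃ k < n, tpow A n i j ≤ tpow A k i j := by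
  rcases eq_or_ne (tpow A n i j) ⊥ with h | h
  · exact ⟨0, i.pos, by simp [h]⟩
  obtain ⟨w, hw0, hwn, hw⟩ := exists_walk h
  obtain ⟨a, b, -, hab, hb, hwab⟩ := exists_repeat w 0
  rw [zero_add] at hb
  refine ⟨a + (n - b), by omega, ?_⟩
  rw [← hw, ← walkWeight_add A w (Nat.zero_le a) (hab.le.trans hb),
    ← walkWeight_add A w hab.le hb]
  have h1 := walkWeight_le_tpow_sub A w (Nat.zero_le a)
  have h2 := walkWeight_le_tpow_sub A w hab.le
  have h3 := walkWeight_le_tpow_sub A w hb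
  rw [hw0] at h1
  rw [← hwab] at h2 h3
  rw [hwn] at h3
  have h4 := h2.trans (hA (b - a) (by omega) (by omega) _)
  calc _ ≤ tpow A (a - 0) i (w a) + (0 + tpow A (n - b) (w a) j) := by gcongr
    _ ≤ _ := by rw [zero_add]; exact le_tpow_add A a (n - b) i (w a) j

/-! Stabilization of the entries of powers next to a node with a loop of weight `0`. -/

/-- A walk that ends at `c` can wait there at no cost. -/
theorem tpow_col_mono {n : ℕ} {C : TMat n n} {c : Fin n} (hc : C c c = 0) (i : Fin n) :
    Monotone fun m => tpow C m i c := by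
  refine monotone_nat_of_le_succ fun m => ?_
  have := le_tmul (tpow C m) C i c c
  rwa [hc, add_zero] at this

theorem tpow_row_mono {n : ℕ} {C : TMat n n} {c : Fin n} (hc : C c c = 0) (j : Fin n) :
    Monotone fun m => tpow C m c j := by
  refine monotone_nat_of_le_succ fun m => ?_
  have := le_tpow_add C 1 m c c j
  rwa [tpow_one, hc, zero_add, add_comm 1] at this

/-- A circuit can be cut out of the last `n` steps; waiting at `c` then brings these steps back up
to exactly `n - 1`. So a length above `n` can be lowered by one without loss. -/
theorem tpow_col_le {n : ℕ} {C : TMat n n} (hC : ∀ i j, C i j ≤ 0) {c : Fin n} (hc : C c c = 0)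
    (i : Fin n) (m : ℕ) : tpow C m i c ≤ tpow C n i c := by
  rcases le_total m n with h | h
  · exact tpow_col_mono hc i h
  induction m, h using Nat.le_induction with
  | base => exact le_rfl
  | succ m h ih =>
    refine le_trans ?_ ih
    have e1 : m + 1 = (m + 1 - n) + n := by omega
    rw [e1, tpow_add, tmul_le_iff]
    intro k
    obtain ⟨l, hl, hkl⟩ := tpow_card_le (fun k _ _ i => tpow_nonpos hC k i i) k c
    have h2 : tpow C n k c ≤ tpow C (n - 1) k c := hkl.trans (tpow_col_mono hc k (by omega))
    refine (add_le_add le_rfl h2).trans ((le_tpow_add C _ _ i k c).trans_eq ?_)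
    congr 1
    omega

theorem tpow_row_le {n : ℕ} {C : TMat n n} (hC : ∀ i j, C i j ≤ 0) {c : Fin n} (hc : C c c = 0)
    (j : Fin n) (m : ℕ) : tpow C m c j ≤ tpow C n c j := by
  rcases le_total m n with h | h
  · exact tpow_row_mono hc j h
  induction m, h using Nat.le_induction with
  | base => exact le_rfl
  | succ m h ih =>
    refine le_trans ?_ ih
    have e1 : m + 1 = n + (m + 1 - n) := by omega
    rw [e1, tpow_add, tmul_le_iff]
    intro k
    obtain ⟨l, hl, hkl⟩ := tpow_card_le (fun k _ _ i => tpow_nonpos hC k i i) c k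
    have h2 : tpow C n c k ≤ tpow C (n - 1) c k := hkl.trans (tpow_row_mono hc k (by omega))
    refine (add_le_add h2 le_rfl).trans ((le_tpow_add C _ _ c k j).trans_eq ?_)
    congr 1
    omega

/-- If the diagonal entries are `0` and the others are nonpositive, then powers stabilize. -/
theorem tpow_eq_of_diag {n : ℕ} {C : TMat n n} (hC : ∀ i j, C i j ≤ 0) (hd : ∀ i, C i i = 0)
    {m : ℕ} (hm : n ≤ m) : tpow C m = tpow C n := by
  funext i j
  exact le_antisymm (tpow_col_le hC (hd j) i m) (tpow_col_mono (hd j) i hm)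

/-! ### Normalization by a potential -/

/-- Diagonal similarity by the potential `u`, together with a translation by `-r`. -/
def normalize {n : ℕ} (A : TMat n n) (u : Fin n → ℝ) (r : ℝ) : TMat n n :=
  fun i j => A i j + ((u j - u i - r : ℝ) : T)

theorem add_coe_eq_iff {x y : T} {c : ℝ} : x + (c : T) = y ↔ x = y + ((-c : ℝ) : T) := by
  constructor
  · rintro rfl
    rw [add_assoc, ← WithBot.coe_add]
    simp
  · rintro rfl
    rw [add_assoc, ← WithBot.coe_add]
    simp

theorem tpow_normalize {n : ℕ} (A : TMat n n) (u : Fin n → ℝ) (r : ℝ) (k : ℕ) (i j : Fin n) :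
    tpow (normalize A u r) k i j = tpow A k i j + ((u j - u i - k * r : ℝ) : T) := by
  induction k generalizing j with
  | zero =>
    rcases eq_or_ne i j with rfl | h
    · simp [tpow, tone]
    · simp [tpow, tone, h]
  | succ k ih =>
    have key : ∀ l, tpow (normalize A u r) k i l + normalize A u r l j =
        (tpow A k i l + A l j) + ((u j - u i - (k + 1 : ℕ) * r : ℝ) : T) := by
      intro l
      rw [ih, normalize, add_add_add_comm, ← WithBot.coe_add]
      congr 2
      push_cast
      ring
    apply le_antisymm
    · refine tmul_le_iff.2 fun l => ?_
      rw [key]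
      exact add_le_add (le_tmul (tpow A k) A i l j) le_rfl
    · rcases eq_or_ne (tpow A (k + 1) i j) ⊥ with h | h
      · simp [h]
      obtain ⟨l, hl⟩ := exists_tmul_eq (A := tpow A k) (B := A) h
      rw [tpow, hl, ← key]
      exact le_tmul _ _ _ _ _

/-- The potentials cancel because `σ` is a bijection: all weights are shifted by the same constant,
so optimality is unaffected. -/
theorem permWeight_normalize {n : ℕ} (A : TMat n n) (u : Fin n → ℝ) (r : ℝ)
    (σ : Equiv.Perm (Fin n)) :
    permWeight (normalize A u r) σ = permWeight A σ + ((-(n * r) : ℝ) : T) := by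
  have h : ∑ i, (u (σ i) - u i - r) = -(n * r) := by
    rw [sum_sub_distrib, sum_sub_distrib, Equiv.sum_comp σ u]
    simp
  rw [← h, permWeight, permWeight]
  simp only [normalize]
  rw [sum_add_distrib]
  congr 1
  exact (map_sum (WithBot.addHom (α := ℝ)) _ _).symm

/-! ### Closed sequences and closed walks -/

/-- The closed sequence of a closed walk. -/
def closedSeqOfWalk {n : ℕ} (w : ℕ → Fin n) (ℓ : ℕ) : ClosedSeq n := ⟨ℓ, fun t => w t⟩

theorem closedSeqOfWalk_succ {n : ℕ} {w : ℕ → Fin n} {ℓ : ℕ} (hw : w (ℓ + 1) = w 0)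
    (t : Fin ((closedSeqOfWalk w ℓ).ℓ + 1)) :
    (closedSeqOfWalk w ℓ).node (t + 1) = w (t.1 + 1) := by
  have e : (closedSeqOfWalk w ℓ).node (t + 1) = w ((t + 1 : Fin _) : ℕ) := rfl
  rw [e, Fin.val_add_one]
  split_ifs with h
  · rw [h, ← hw]; rfl
  · rfl

theorem sum_closedSeqOfWalk {n : ℕ} (A : TMat n n) {w : ℕ → Fin n} {ℓ : ℕ}
    (hw : w (ℓ + 1) = w 0) :
    ∑ t, A ((closedSeqOfWalk w ℓ).node t) ((closedSeqOfWalk w ℓ).node (t + 1)) =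
      walkWeight A w 0 (ℓ + 1) := by
  rw [walkWeight, Nat.Ico_zero_eq_range, sum_range]
  exact sum_congr rfl fun t _ => by rw [closedSeqOfWalk_succ hw]; rfl

theorem meanWeight_le_rho {n : ℕ} (A : TMat n n) {ℓ : ℕ} (hℓ : ℓ < n)
    (x : Fin (ℓ + 1) → Fin n) : meanWeight A ⟨ℓ, x⟩ ≤ rho A := by
  unfold rho
  exact le_trans (Finset.le_sup (f := fun x : Fin (ℓ + 1) → Fin n => meanWeight A ⟨ℓ, x⟩)
    (mem_univ x)) (Finset.le_sup (f := fun l : Fin n => univ.sup fun x : Fin (l.1 + 1) → Fin n =>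
      meanWeight A ⟨l.1, x⟩) (mem_univ (⟨ℓ, hℓ⟩ : Fin n)))

theorem meanWeight_eq_coe_iff {n : ℕ} {A : TMat n n} {c : ClosedSeq n} {r : ℝ} :
    meanWeight A c = (r : T) ↔
      ∑ t, A (c.node t) (c.node (t + 1)) = (((c.ℓ + 1 : ℝ) * r : ℝ) : T) := by
  have : (0 : ℝ) < c.ℓ + 1 := by positivity
  unfold meanWeight
  generalize (∑ t, A (c.node t) (c.node (t + 1)) : T) = x
  cases x using WithBot.recBotCoe with
  | bot =>
    exact ⟨fun h => absurd h.symm WithBot.coe_ne_bot, fun h => absurd h.symm WithBot.coe_ne_bot⟩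
  | coe x =>
    rw [WithBot.map_coe, WithBot.coe_inj, WithBot.coe_inj, div_eq_iff this.ne', mul_comm]

theorem meanWeight_le_coe_iff {n : ℕ} {A : TMat n n} {c : ClosedSeq n} {r : ℝ} :
    meanWeight A c ≤ (r : T) ↔
      ∑ t, A (c.node t) (c.node (t + 1)) ≤ (((c.ℓ + 1 : ℝ) * r : ℝ) : T) := by
  have : (0 : ℝ) < c.ℓ + 1 := by positivity
  unfold meanWeight
  generalize (∑ t, A (c.node t) (c.node (t + 1)) : T) = x
  cases x using WithBot.recBotCoe with
  | bot => simp
  | coe x =>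
    rw [WithBot.map_coe, WithBot.coe_le_coe, WithBot.coe_le_coe, div_le_iff₀ this, mul_comm]

theorem meanWeight_eq_bot_iff {n : ℕ} {A : TMat n n} {c : ClosedSeq n} :
    meanWeight A c = ⊥ ↔ ∑ t, A (c.node t) (c.node (t + 1)) = ⊥ := by
  unfold meanWeight
  exact WithBot.map_eq_bot_iff

/-- If there is no circuit, then the matrix is nilpotent. -/
theorem tpow_eq_nullMat {n : ℕ} {A : TMat n n} (h : rho A = ⊥) : tpow A n = nullMat n n := by
  funext i j
  by_contra hij
  obtain ⟨w, -, -, hw⟩ := exists_walk hij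
  obtain ⟨a, b, -, hab, hb, hwab⟩ := exists_repeat w 0
  rw [zero_add] at hb
  obtain ⟨ℓ, rfl⟩ : ∃ ℓ, b = a + (ℓ + 1) := ⟨b - a - 1, by omega⟩
  have h1 : walkWeight A w a (a + (ℓ + 1)) ≠ ⊥ := by
    intro h0
    apply hij
    rw [← hw, ← walkWeight_add A w (Nat.zero_le a) (hab.le.trans hb),
      ← walkWeight_add A w hab.le hb, h0]
    simp [nullMat]
  have h2 := meanWeight_le_rho A (ℓ := ℓ) (by omega)
    (closedSeqOfWalk (fun t => w (a + t)) ℓ).node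
  rw [h, le_bot_iff] at h2
  have h3 := meanWeight_eq_bot_iff.1 h2
  apply h1
  have h4 := sum_closedSeqOfWalk A (w := fun t => w (a + t)) (ℓ := ℓ) hwab.symm
  have h5 : walkWeight A w a (a + (ℓ + 1)) = walkWeight A (fun t => w (a + t)) 0 (ℓ + 1) := by
    rw [walkWeight, walkWeight, sum_Ico_eq_sum_range, Nat.Ico_zero_eq_range]
    simp [add_assoc]
  rw [h5, ← h4]
  exact h3

/-- The bound `k ≤ n` is there because `rho` only sees closed sequences of length at most `n`;
longer ones are controlled by the potential. -/
theorem tpow_diag_nonpos {n : ℕ} {A : TMat n n} {r : ℝ} (h : rho A = r) {k : ℕ} (hk : 1 ≤ k)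
    (hkn : k ≤ n) (i : Fin n) : tpow A k i i ≤ ((k * r : ℝ) : T) := by
  rcases eq_or_ne (tpow A k i i) ⊥ with h0 | h0
  · simp [h0]
  obtain ⟨w, hw0, hwk, hw⟩ := exists_walk h0
  obtain ⟨ℓ, rfl⟩ : ∃ ℓ, k = ℓ + 1 := ⟨k - 1, by omega⟩
  have h2 := meanWeight_le_rho A (ℓ := ℓ) (by omega) (closedSeqOfWalk w ℓ).node
  rw [h] at h2
  have h3 := meanWeight_le_coe_iff.1 h2
  rw [← hw, ← sum_closedSeqOfWalk A (hwk.trans hw0.symm)]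
  refine h3.trans_eq ?_
  simp

/-- A potential that bounds the entries of the matrix. -/
theorem exists_potential {n : ℕ} {A : TMat n n} {r : ℝ} (h : rho A = r) :
    ∃ u : Fin n → ℝ, ∀ i j, normalize A u r i j ≤ 0 := by
  set A₁ := normalize A 0 r with hA₁
  have hdiag : ∀ k, 1 ≤ k → k ≤ n → ∀ i, tpow A₁ k i i ≤ 0 := by
    intro k hk hkn i
    rw [hA₁, tpow_normalize]
    refine (add_le_add (tpow_diag_nonpos h hk hkn i) le_rfl).trans_eq ?_
    rw [← WithBot.coe_add]
    simp
  -- The potential is the best weight of a walk of fewer than `n` steps from `i`. It is finite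
  -- thanks to the empty walk, and walks of `n` steps do no better, so prepending an arc to an
  -- optimal walk gives `A₁ i j + v j ≤ v i`.
  set v : Fin n → T := fun i => (range n).sup fun k => univ.sup fun j => tpow A₁ k i j with hv
  have le_v : ∀ k < n, ∀ i j, tpow A₁ k i j ≤ v i := fun k hk i j =>
    le_trans (Finset.le_sup (f := fun j => tpow A₁ k i j) (mem_univ j))
      (Finset.le_sup (f := fun k => univ.sup fun j => tpow A₁ k i j) (mem_range.2 hk))
  have le_v' : ∀ k ≤ n, ∀ i j, tpow A₁ k i j ≤ v i := by
    intro k hk i j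
    rcases hk.lt_or_eq with hk | rfl
    · exact le_v k hk i j
    · obtain ⟨l, hl, hle⟩ := tpow_card_le hdiag i j
      exact hle.trans (le_v l hl i j)
  have hv0 : ∀ i, v i ≠ ⊥ := by
    intro i h0
    have := le_v 0 i.pos i i
    rw [h0, tpow_zero_diag] at this
    simp at this
  choose u hu using fun i => WithBot.ne_bot_iff_exists.1 (hv0 i)
  have hstep : ∀ i j, A₁ i j + v j ≤ v i := by
    intro i j
    obtain ⟨k, hk, hk'⟩ := exists_mem_eq_sup (range n) ⟨0, mem_range.2 i.pos⟩
      fun k => univ.sup fun l => tpow A₁ k j l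
    obtain ⟨l, -, hl⟩ := exists_mem_eq_sup univ ⟨i, mem_univ i⟩ fun l => tpow A₁ k j l
    have e : v j = tpow A₁ k j l := hk'.trans hl
    rw [e]
    rw [mem_range] at hk
    have := le_tpow_add A₁ 1 k i j l
    rw [tpow_one] at this
    exact this.trans (le_v' _ (by omega) i l)
  refine ⟨u, fun i j => ?_⟩
  have := hstep i j
  rw [← hu, ← hu] at this
  simp only [hA₁, normalize] at this ⊢
  cases hx : A i j using WithBot.recBotCoe with
  | bot => simp
  | coe x =>
    rw [hx] at this
    norm_cast at this ⊢
    simp only [Pi.zero_apply] at this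
    linarith

/-! ### The critical graph of a normalized matrix -/

theorem eq_zero_of_add_eq_zero {x y : T} (hx : x ≤ 0) (hy : y ≤ 0) (h : x + y = 0) :
    x = 0 ∧ y = 0 := by
  constructor
  · refine le_antisymm hx ?_
    rw [← h]
    exact (add_le_add le_rfl hy).trans_eq (add_zero x)
  · refine le_antisymm hy ?_
    rw [← h]
    exact (add_le_add hx le_rfl).trans_eq (zero_add y)

theorem sum_node_normalize {n : ℕ} (A : TMat n n) (u : Fin n → ℝ) (r : ℝ) (c : ClosedSeq n) :
    ∑ t, normalize A u r (c.node t) (c.node (t + 1)) =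
      ∑ t, A (c.node t) (c.node (t + 1)) + ((-((c.ℓ + 1) * r) : ℝ) : T) := by
  have h : ∑ t, (u (c.node (t + 1)) - u (c.node t) - r) = -((c.ℓ + 1) * r) := by
    have e := Equiv.sum_comp (Equiv.addRight (1 : Fin (c.ℓ + 1))) (fun t => u (c.node t))
    simp only [Equiv.coe_addRight] at e
    rw [sum_sub_distrib, sum_sub_distrib, e]
    simp
  rw [← h]
  simp only [normalize]
  rw [sum_add_distrib]
  congr 1
  exact (map_sum (WithBot.addHom (α := ℝ)) _ _).symm

/-- The potentials telescope around a closed sequence of any length, so criticality says that a sum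
of nonpositive terms vanishes. -/
theorem isCritical_iff {n : ℕ} {A : TMat n n} {u : Fin n → ℝ} {r : ℝ} (h : rho A = r)
    (hu : ∀ i j, normalize A u r i j ≤ 0) (c : ClosedSeq n) :
    IsCritical A c ↔ ∀ t, normalize A u r (c.node t) (c.node (t + 1)) = 0 := by
  have key : meanWeight A c = rho A ↔
      ∀ t, normalize A u r (c.node t) (c.node (t + 1)) = 0 := by
    rw [h, meanWeight_eq_coe_iff]
    have h1 := sum_eq_zero_iff_of_nonpos (s := univ)
      (f := fun t => normalize A u r (c.node t) (c.node (t + 1))) fun t _ => hu _ _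
    simp only [mem_univ, true_imp_iff] at h1
    rw [← h1, sum_node_normalize, add_coe_eq_iff]
    simp
  refine ⟨fun hc => key.1 hc.2, fun hc => ⟨fun t h0 => ?_, key.2 hc⟩⟩
  have := hc t
  rw [normalize, h0] at this
  simp at this

theorem ofNat_succ (ℓ k : ℕ) : Fin.ofNat (ℓ + 1) (k + 1) = Fin.ofNat (ℓ + 1) k + 1 := by
  apply Fin.ext
  simp [Fin.val_add]

theorem ofNat_self (ℓ : ℕ) : Fin.ofNat (ℓ + 1) (ℓ + 1) = 0 := by
  apply Fin.ext
  simp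

theorem tpow_node_eq_zero {n : ℕ} {A : TMat n n} (hA : ∀ i j, A i j ≤ 0) {c : ClosedSeq n}
    (hc : ∀ t, A (c.node t) (c.node (t + 1)) = 0) (t : Fin (c.ℓ + 1)) (k : ℕ) :
    tpow A k (c.node t) (c.node (t + Fin.ofNat (c.ℓ + 1) k)) = 0 := by
  refine le_antisymm (tpow_nonpos hA _ _ _) ?_
  have h := walkWeight_le_tpow A (fun k => c.node (t + Fin.ofNat (c.ℓ + 1) k)) 0 k
  have h0 : walkWeight A (fun k => c.node (t + Fin.ofNat (c.ℓ + 1) k)) 0 (0 + k) = 0 := by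
    refine sum_eq_zero fun s _ => ?_
    simp only [ofNat_succ, ← add_assoc]
    exact hc _
  rw [h0] at h
  simpa using h

/-- The arcs of the critical graph are the arcs of weight `0` of the normalized matrix that belong
to a closed walk of weight `0`. -/
theorem mem_criticalGraph_arcs_iff {n : ℕ} {A : TMat n n} {u : Fin n → ℝ} {r : ℝ}
    (h : rho A = r) (hu : ∀ i j, normalize A u r i j ≤ 0) (i j : Fin n) :
    (i, j) ∈ (criticalGraph A).arcs ↔
      normalize A u r i j = 0 ∧ ∃ m, tpow (normalize A u r) m j i = 0 := by
  simp only [criticalGraph, unionGraph, ClosedSeq.graph, Set.mem_iUnion, Set.mem_ofPred_eq,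
    Set.mem_range, Prod.mk.injEq, exists_prop]
  constructor
  · rintro ⟨c, hc, t, rfl, rfl⟩
    rw [isCritical_iff h hu] at hc
    refine ⟨hc t, c.ℓ, ?_⟩
    have := tpow_node_eq_zero hu hc (t + 1) c.ℓ
    rwa [add_assoc, add_comm 1, ← ofNat_succ, ofNat_self, add_zero] at this
  · rintro ⟨hij, m, hm⟩
    obtain ⟨w, hw0, hwm, hw⟩ := exists_walk (by rw [hm]; simp : tpow (normalize A u r) m j i ≠ ⊥)
    rw [hm, walkWeight, sum_eq_zero_iff_of_nonpos fun t _ => hu _ _] at hw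
    -- The arc `(i, j)` followed by the walk from `j` back to `i`: a closed walk of `m + 1` arcs,
    -- hence with field `ℓ = m`.
    let w' : ℕ → Fin n := fun t => if t = 0 then i else w (t - 1)
    have hw' : w' (m + 1) = w' 0 := by simp [w', hwm]
    refine ⟨closedSeqOfWalk w' m, ?_, 0, rfl, ?_⟩
    · rw [isCritical_iff h hu]
      intro t
      rw [closedSeqOfWalk_succ hw']
      change normalize A u r (w' t) _ = 0
      rcases Nat.eq_zero_or_pos t.1 with h0 | h0
      · simp [w', h0, hw0, hij]
      · have ht : t.1 < m + 1 := t.2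
        have := hw (t.1 - 1) (by simp; omega)
        simpa [w', h0.ne', Nat.sub_add_cancel h0] using this
    · rw [closedSeqOfWalk_succ hw']
      simp [w', hw0]

theorem mem_criticalGraph_nodes_iff {n : ℕ} {A : TMat n n} {u : Fin n → ℝ} {r : ℝ}
    (h : rho A = r) (hu : ∀ i j, normalize A u r i j ≤ 0) (i : Fin n) :
    i ∈ (criticalGraph A).nodes ↔ ∃ m, 1 ≤ m ∧ tpow (normalize A u r) m i i = 0 := by
  constructor
  · simp only [criticalGraph, unionGraph, ClosedSeq.graph, Set.mem_iUnion, Set.mem_ofPred_eq,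
      Set.mem_range, exists_prop]
    rintro ⟨c, hc, t, rfl⟩
    rw [isCritical_iff h hu] at hc
    refine ⟨c.ℓ + 1, by omega, ?_⟩
    have := tpow_node_eq_zero hu hc t (c.ℓ + 1)
    rwa [ofNat_self, add_zero] at this
  · rintro ⟨m, hm, hi⟩
    obtain ⟨m, rfl⟩ : ∃ k, m = k + 1 := ⟨m - 1, by omega⟩
    rw [add_comm, tpow_add, tpow_one] at hi
    obtain ⟨j, hj⟩ := exists_tmul_eq (by rw [hi]; simp : tmul (normalize A u r) _ i i ≠ ⊥)
    rw [hi, eq_comm] at hj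
    replace hj := eq_zero_of_add_eq_zero (hu _ _) (tpow_nonpos hu _ _ _) hj
    exact ((criticalGraph A).mem_of_arc (i, j)
      ((mem_criticalGraph_arcs_iff h hu i j).2 ⟨hj.1, m, hj.2⟩)).1

theorem exists_arc_of_mem_nodes {n : ℕ} {A : TMat n n} {i : Fin n}
    (hi : i ∈ (criticalGraph A).nodes) :
    (∃ j, (i, j) ∈ (criticalGraph A).arcs) ∧ ∃ j, (j, i) ∈ (criticalGraph A).arcs := by
  simp only [criticalGraph, unionGraph, ClosedSeq.graph, Set.mem_iUnion, Set.mem_ofPred_eq,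
    Set.mem_range, exists_prop, Prod.mk.injEq] at hi ⊢
  obtain ⟨c, hc, t, rfl⟩ := hi
  exact ⟨⟨_, c, hc, t, rfl, rfl⟩, ⟨_, c, hc, t - 1, rfl, by rw [sub_add_cancel]⟩⟩

theorem exists_mem_criticalGraph_nodes {n : ℕ} {A : TMat n n} {r : ℝ} (h : rho A = r) :
    ∃ i, i ∈ (criticalGraph A).nodes := by
  have hn : (univ : Finset (Fin n)).Nonempty := by
    rw [nonempty_iff_ne_empty]
    intro h0
    rw [rho, h0] at h
    simp at h
  have := hn.to_type
  obtain ⟨l, -, hl⟩ := exists_mem_eq_sup univ hn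
    fun l : Fin n => univ.sup fun x : Fin (l.1 + 1) → Fin n => meanWeight A ⟨l.1, x⟩
  obtain ⟨x, -, hx⟩ := exists_mem_eq_sup univ univ_nonempty
    fun x : Fin (l.1 + 1) → Fin n => meanWeight A ⟨l.1, x⟩
  have hc : meanWeight A ⟨l.1, x⟩ = rho A := (hl.trans hx).symm
  refine ⟨x 0, ?_⟩
  simp only [criticalGraph, unionGraph, Set.mem_iUnion, Set.mem_ofPred_eq, exists_prop]
  refine ⟨⟨l.1, x⟩, ⟨fun t h0 => ?_, hc⟩, ⟨0, rfl⟩⟩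
  rw [h, meanWeight_eq_coe_iff] at hc
  have : ∑ t, A (x t) (x (t + 1)) = ⊥ := by
    rw [← Finset.add_sum_erase _ _ (mem_univ t)]
    rw [show A (x t) (x (t + 1)) = ⊥ from h0, WithBot.bot_add]
  exact WithBot.coe_ne_bot (hc.symm.trans this)

theorem criticalGraph_nodes_eq_empty {n : ℕ} {A : TMat n n} (h : rho A = ⊥) :
    (criticalGraph A).nodes = ∅ := by
  rw [Set.eq_empty_iff_forall_notMem]
  intro i hi
  simp only [criticalGraph, unionGraph, Set.mem_iUnion, Set.mem_ofPred_eq, exists_prop] at hi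
  obtain ⟨c, ⟨hc, hm⟩, -⟩ := hi
  rw [h, meanWeight_eq_bot_iff, WithBot.sum_eq_bot_iff] at hm
  obtain ⟨t, -, ht⟩ := hm
  exact hc t ht

/-! ### Ranks of matrices with a dependent row -/

/-- Some row is a max-plus combination of the other ones. -/
def HasDependentRow {n m : ℕ} (B : TMat n m) : Prop :=
  ∃ i, ∃ a : Fin n → T, ∀ j, B i j = (univ.erase i).sup fun k => a k + B k j

/-- The permutation `θ` has a finite weight, greater than that of all the other ones. -/
def IsStrictMax {n : ℕ} (B : TMat n n) (θ : Equiv.Perm (Fin n)) : Prop :=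
  permWeight B θ ≠ ⊥ ∧ ∀ σ, σ ≠ θ → permWeight B σ < permWeight B θ

theorem add_finset_sup {ι : Type*} (c : T) (s : Finset ι) (f : ι → T) :
    c + s.sup f = s.sup fun i => c + f i :=
  apply_sup_eq_sup_comp_of_linearOrder (g := fun x => c + x)
    (fun _ _ h => add_le_add le_rfl h) (WithBot.add_bot c)

theorem finset_sup_add {ι : Type*} (c : T) (s : Finset ι) (f : ι → T) :
    s.sup f + c = s.sup fun i => f i + c := by
  simp only [add_comm _ c, add_finset_sup]

theorem permWeight_eq_bot {n : ℕ} {B : TMat n n} {σ : Equiv.Perm (Fin n)} {i : Fin n}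
    (h : B i (σ i) = ⊥) : permWeight B σ = ⊥ :=
  WithBot.sum_eq_bot_iff.2 ⟨i, mem_univ i, h⟩

theorem permWeight_le_per {n : ℕ} (B : TMat n n) (σ : Equiv.Perm (Fin n)) :
    permWeight B σ ≤ per B :=
  Finset.le_sup (f := fun σ => permWeight B σ) (mem_univ σ)

theorem exists_permWeight_eq_per {n : ℕ} (B : TMat n n) : ∃ σ, permWeight B σ = per B := by
  obtain ⟨σ, -, h⟩ := exists_mem_eq_sup univ univ_nonempty fun σ => permWeight B σ
  exact ⟨σ, h.symm⟩

/-- Exchanging the images of two rows does not decrease the weight of a permutation. -/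
theorem exists_permWeight_le {n : ℕ} {B : TMat n n} (hB : HasDependentRow B)
    (σ : Equiv.Perm (Fin n)) :
    permWeight B σ = ⊥ ∨
      ∃ i k, i ≠ k ∧ permWeight B σ ≤ permWeight B (σ * Equiv.swap i k) := by
  obtain ⟨i, a, h⟩ := hB
  rcases eq_or_ne (B i (σ i)) ⊥ with h0 | h0
  · exact Or.inl (permWeight_eq_bot h0)
  have hne : (univ.erase i).Nonempty := by
    rw [nonempty_iff_ne_empty]
    intro he
    rw [h, he] at h0
    simp at h0
  obtain ⟨k, hk, hk'⟩ := exists_mem_eq_sup _ hne fun k => a k + B k (σ i)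
  rw [← h] at hk'
  have hki : k ≠ i := (mem_erase.1 hk).1
  refine Or.inr ⟨i, k, hki.symm, ?_⟩
  -- As `B i (σ i) = a k + B k (σ i)`, the scalar `a k` can be handed over to the other factor `B k
  -- (σ k)`, where row `i` absorbs it.
  have hle : a k + B k (σ k) ≤ B i (σ k) := by
    rw [h]
    exact Finset.le_sup (f := fun l => a l + B l (σ k)) hk
  have split : ∀ τ : Equiv.Perm (Fin n), permWeight B τ =
      B i (τ i) + (B k (τ k) + ∑ l ∈ (univ.erase i).erase k, B l (τ l)) := by
    intro τ
    rw [permWeight, ← add_sum_erase _ _ (mem_univ i), ← add_sum_erase _ _ hk]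
  have hrest : ∑ l ∈ (univ.erase i).erase k, B l ((σ * Equiv.swap i k) l) =
      ∑ l ∈ (univ.erase i).erase k, B l (σ l) := by
    refine sum_congr rfl fun l hl => ?_
    simp only [mem_erase] at hl
    rw [Equiv.Perm.mul_apply, Equiv.swap_apply_of_ne_of_ne hl.2.1 hl.1]
  rw [split, split (σ * _), hrest]
  simp only [Equiv.Perm.mul_apply, Equiv.swap_apply_left, Equiv.swap_apply_right]
  rw [← add_assoc, ← add_assoc, hk']
  refine add_le_add ?_ le_rfl
  calc a k + B k (σ i) + B k (σ k) = a k + B k (σ k) + B k (σ i) := by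
        rw [add_assoc, add_comm (B k (σ i)), ← add_assoc]
    _ ≤ _ := by gcongr

theorem mul_swap_ne {n : ℕ} (σ : Equiv.Perm (Fin n)) {i k : Fin n} (h : i ≠ k) :
    σ * Equiv.swap i k ≠ σ := by
  intro he
  rw [mul_eq_left, Equiv.swap_eq_one_iff] at he
  exact h he

/-- The exchange turns an optimal permutation into another one. If the permanent is `-∞`, all
permutations are optimal, and there are two of them unless `n = 1`: this is the exceptional clause
of `Nonsingular`. -/
theorem HasDependentRow.not_nonsingular {n : ℕ} {B : TMat n n} (hB : HasDependentRow B) :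
    ¬ Nonsingular B := by
  rw [Nonsingular, not_not]
  obtain ⟨σ, hσ⟩ := exists_permWeight_eq_per B
  rcases exists_permWeight_le hB σ with h | ⟨i, k, hik, h⟩
  · have hall : ∀ τ, permWeight B τ = per B := fun τ => by
      rw [← hσ, h, ← le_bot_iff, ← h, hσ]
      exact permWeight_le_per B τ
    rcases subsingleton_or_nontrivial (Fin n) with hs | hs
    · obtain ⟨i, -⟩ := hB
      left
      have hn : n = 1 := le_antisymm (Fin.subsingleton_iff_le_one.1 hs) i.pos
      refine ⟨hn, ?_⟩
      subst hn
      funext p q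
      rw [permWeight, Fintype.sum_subsingleton _ p] at h
      rw [Subsingleton.elim q (σ p), h]
      rfl
    · obtain ⟨p, q, hpq⟩ := exists_pair_ne (Fin n)
      exact Or.inr ⟨σ, σ * Equiv.swap p q, (mul_swap_ne σ hpq).symm, hσ, hall _⟩
  · refine Or.inr ⟨σ, σ * Equiv.swap i k, (mul_swap_ne σ hik).symm, hσ, ?_⟩
    exact le_antisymm (permWeight_le_per _ _) (hσ ▸ h)

/-- The exchange reverses the sign, so each parity dominates the other. -/
theorem HasDependentRow.detPlus_eq {n : ℕ} {B : TMat n n} (hB : HasDependentRow B) :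
    detPlus B = detMinus B := by
  apply le_antisymm
  · refine Finset.sup_le fun σ hσ => ?_
    rw [mem_filter] at hσ
    rcases exists_permWeight_le hB σ with h | ⟨i, k, hik, h⟩
    · simp [h]
    · refine h.trans (Finset.le_sup (f := fun σ => permWeight B σ) ?_)
      simp [hσ.2, Equiv.Perm.sign_swap hik]
  · refine Finset.sup_le fun σ hσ => ?_
    rw [mem_filter] at hσ
    rcases exists_permWeight_le hB σ with h | ⟨i, k, hik, h⟩
    · simp [h]
    · refine h.trans (Finset.le_sup (f := fun σ => permWeight B σ) ?_)
      simp [hσ.2, Equiv.Perm.sign_swap hik]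

/-- Makes the matrix itself its only submatrix of full size. -/
theorem orderEmbedding_eq_id {n : ℕ} (f : Fin n ↪o Fin n) : ⇑f = id := by
  have hs : Function.Surjective f := Finite.surjective_of_injective f.injective
  have : RelIso.ofSurjective f hs = OrderIso.refl (Fin n) := Subsingleton.elim _ _
  funext i
  exact congrArg (fun e : Fin n ≃o Fin n => e i) this

theorem sSup_lt_of_le {n : ℕ} (hn : 0 < n) {S : Set ℕ} (h : ∀ r ∈ S, r ≤ n) (hS : n ∉ S) :
    sSup S < n := by
  have : sSup S ≤ n - 1 := csSup_le' fun r hr => by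
    have := h r hr
    have : r ≠ n := fun e => hS (e ▸ hr)
    omega
  omega

theorem sSup_eq_of_le {n : ℕ} {S : Set ℕ} (h : ∀ r ∈ S, r ≤ n) (hS : n ∈ S) : sSup S = n :=
  le_antisymm (csSup_le' h) (le_csSup ⟨n, h⟩ hS)

theorem le_of_orderEmbedding {r n : ℕ} (f : Fin r ↪o Fin n) : r ≤ n := by
  simpa using Fintype.card_le_of_embedding f.toEmbedding

theorem HasDependentRow.pos {n m : ℕ} {B : TMat n m} (hB : HasDependentRow B) : 0 < n :=
  hB.choose.pos

theorem HasDependentRow.tropicalRank_lt {n : ℕ} {B : TMat n n} (hB : HasDependentRow B) :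
    tropicalRank B < n := by
  refine sSup_lt_of_le hB.pos (fun r ⟨f, _⟩ => le_of_orderEmbedding f) ?_
  rintro ⟨f, g, h⟩
  rw [orderEmbedding_eq_id f, orderEmbedding_eq_id g] at h
  exact hB.not_nonsingular h

theorem HasDependentRow.symmetrizedRank_lt {n : ℕ} {B : TMat n n} (hB : HasDependentRow B) :
    symmetrizedRank B < n := by
  refine sSup_lt_of_le hB.pos (fun r ⟨f, _⟩ => le_of_orderEmbedding f) ?_
  rintro ⟨f, g, h⟩
  rw [orderEmbedding_eq_id f, orderEmbedding_eq_id g] at h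
  exact h hB.detPlus_eq

theorem sup_smulVec_apply {ι : Type*} {m : ℕ} (s : Finset ι) (a : ι → T) (x : ι → Fin m → T)
    (j : Fin m) : (s.sup fun i => smulVec (a i) (x i)) j = s.sup fun i => a i + x i j := by
  rw [Finset.sup_apply]
  rfl

theorem HasDependentRow.gmRowRank_lt {n m : ℕ} {B : TMat n m} (hB : HasDependentRow B) :
    gmRowRank B < n := by
  refine sSup_lt_of_le hB.pos (fun r ⟨f, _⟩ => le_of_orderEmbedding f) ?_
  rintro ⟨f, h⟩
  rw [orderEmbedding_eq_id f] at h
  obtain ⟨i, a, hi⟩ := hB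
  -- The coefficient `0` of row `i` keeps the relation nontrivial even when all the `a k` are `-∞`.
  refine h {i} (univ.erase i) (Function.update a i 0) (by simp) ⟨i, by simp, by simp⟩ ?_
  funext j
  rw [sup_smulVec_apply, sup_smulVec_apply]
  simp only [sup_singleton, Function.update_self, zero_add, id, hi]
  refine sup_congr rfl fun k hk => ?_
  rw [Function.update_of_ne (mem_erase.1 hk).1]

/-! ### Lifting to series and the Kapranov rank -/

/-- The monic monomial of given valuation. -/
def lift (x : T) : K := WithBot.recBotCoe 0 (fun c : ℝ => HahnSeries.single (-c) (1 : ℂ)) x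

@[simp]
theorem lift_bot : lift ⊥ = 0 := rfl

@[simp]
theorem lift_coe (c : ℝ) : lift (c : T) = HahnSeries.single (-c) (1 : ℂ) := rfl

theorem lift_add (x y : T) : lift (x + y) = lift x * lift y := by
  cases x using WithBot.recBotCoe with
  | bot => simp
  | coe x =>
    cases y using WithBot.recBotCoe with
    | bot => simp
    | coe y =>
      rw [← WithBot.coe_add, lift_coe, lift_coe, lift_coe, HahnSeries.single_mul_single,
        neg_add, one_mul]

theorem coeff_lift (x : T) (g : ℝ) :
    (lift x).coeff g = if x = ((-g : ℝ) : T) then 1 else 0 := by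
  cases x using WithBot.recBotCoe with
  | bot => simp
  | coe x =>
    rw [lift_coe, HahnSeries.coeff_single]
    simp only [WithBot.coe_inj]
    exact if_congr ⟨fun h => by rw [h, neg_neg], fun h => by rw [h, neg_neg]⟩ rfl rfl

theorem val_zero : val 0 = ⊥ := by simp [val]

theorem val_of_ne_zero {x : K} (h : x ≠ 0) : val x = ((-x.order : ℝ) : T) := by simp [val, h]

theorem val_eq_coe {x : K} {c : ℝ} (h1 : x.coeff (-c) ≠ 0) (h2 : ∀ g < -c, x.coeff g = 0) :
    val x = c := by
  have hx : x ≠ 0 := by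
    rintro rfl
    simp at h1
  rw [val_of_ne_zero hx, WithBot.coe_inj, neg_eq_iff_eq_neg]
  refine le_antisymm (HahnSeries.order_le_of_coeff_ne_zero h1) ?_
  by_contra! hlt
  exact HahnSeries.coeff_order_eq_zero.not.2 hx (h2 _ hlt)

theorem coeff_eq_zero_of_val_lt {x : K} {c : ℝ} (h : val x < (c : T)) : x.coeff (-c) = 0 := by
  rcases eq_or_ne x 0 with rfl | hx
  · simp
  rw [val_of_ne_zero hx, WithBot.coe_lt_coe] at h
  exact HahnSeries.coeff_eq_zero_of_lt_order (by linarith)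

theorem coeff_ne_zero_of_val_eq {x : K} {c : ℝ} (h : val x = (c : T)) : x.coeff (-c) ≠ 0 := by
  have hx : x ≠ 0 := by
    rintro rfl
    rw [val_zero] at h
    exact WithBot.coe_ne_bot h.symm
  rw [val_of_ne_zero hx, WithBot.coe_inj] at h
  rw [← h, neg_neg]
  exact HahnSeries.coeff_order_eq_zero.not.2 hx

theorem val_mul (x y : K) : val (x * y) = val x + val y := by
  rcases eq_or_ne x 0 with rfl | hx
  · simp [val_zero]
  rcases eq_or_ne y 0 with rfl | hy
  · simp [val_zero]
  rw [val_of_ne_zero hx, val_of_ne_zero hy, val_of_ne_zero (mul_ne_zero hx hy),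
    HahnSeries.order_mul hx hy, ← WithBot.coe_add, neg_add]

theorem val_one : val 1 = 0 := by
  rw [val_of_ne_zero one_ne_zero, HahnSeries.order_one]
  simp

theorem val_prod {ι : Type*} (s : Finset ι) (f : ι → K) :
    val (∏ i ∈ s, f i) = ∑ i ∈ s, val (f i) := by
  classical
  induction s using Finset.induction_on with
  | empty => simp [val_one]
  | insert i s hi ih => rw [prod_insert hi, sum_insert hi, val_mul, ih]

theorem val_neg (x : K) : val (-x) = val x := by
  rcases eq_or_ne x 0 with rfl | hx
  · simp
  rw [val_of_ne_zero hx, val_of_ne_zero (neg_ne_zero.2 hx), HahnSeries.order_neg]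

/-- There is no cancellation in a sum of monic monomials. -/
theorem val_sum_lift {ι : Type*} (s : Finset ι) (f : ι → T) :
    val (∑ i ∈ s, lift (f i)) = s.sup f := by
  cases hc : s.sup f using WithBot.recBotCoe with
  | bot =>
    rw [sum_eq_zero, val_zero]
    intro i hi
    rw [Finset.sup_eq_bot_iff] at hc
    rw [hc i hi, lift_bot]
  | coe c =>
    -- Coefficients count indices, so in characteristic zero they vanish only when no index
    -- contributes.
    have hcoeff : ∀ g, (∑ i ∈ s, lift (f i)).coeff g =
        ((s.filter fun i => f i = ((-g : ℝ) : T)).card : ℂ) := by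
      intro g
      rw [HahnSeries.coeff_sum]
      simp only [coeff_lift]
      rw [sum_boole]
    apply val_eq_coe
    · have hne : s.Nonempty := by
        rw [nonempty_iff_ne_empty]
        rintro rfl
        simp at hc
      obtain ⟨i, hi, hi'⟩ := exists_mem_eq_sup s hne f
      rw [hcoeff, Nat.cast_ne_zero, card_ne_zero]
      exact ⟨i, mem_filter.2 ⟨hi, by rw [neg_neg, ← hi', hc]⟩⟩
    · intro g hg
      rw [hcoeff, Nat.cast_eq_zero, card_eq_zero, filter_eq_empty_iff]
      intro i hi he
      have : f i ≤ s.sup f := Finset.le_sup hi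
      rw [hc, he, WithBot.coe_le_coe] at this
      linarith

/-- The lifted columns of `B` span the subspace, and the lifted entries of `C` are the coefficients;
sums of monic monomials do not cancel. Thus the Kapranov rank is at most the Schein rank. -/
theorem exists_tropLinear_of_tmul {n r m : ℕ} (B : TMat n r) (C : TMat r m) :
    ∃ W : Submodule K (Fin n → K), Module.finrank K W ≤ r ∧
      ∀ j, (tmul B C).transpose j ∈ tropLinear W := by
  refine ⟨Submodule.span K (Set.range fun k : Fin r => fun i => lift (B i k)), ?_, fun j => ?_⟩
  · exact (finrank_range_le_card _).trans_eq (Fintype.card_fin r)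
  · refine ⟨∑ k, lift (C k j) • fun i => lift (B i k), ?_, ?_⟩
    · exact Submodule.sum_mem _ fun k _ => Submodule.smul_mem _ _ (Submodule.subset_span ⟨k, rfl⟩)
    · funext i
      simp only [Finset.sum_apply, Pi.smul_apply, smul_eq_mul, ← lift_add, val_sum_lift]
      simp only [Matrix.transpose_apply, tmul, add_comm]

theorem kapranovRank_tmul_le {n r m : ℕ} (B : TMat n r) (C : TMat r m) :
    kapranovRank (tmul B C) ≤ r := by
  obtain ⟨W, hW, h⟩ := exists_tropLinear_of_tmul B C
  have : kapranovRank (tmul B C) ≤ Module.finrank K W := Nat.sInf_le ⟨W, rfl, h⟩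
  exact this.trans hW

/-- A matrix with a dependent row factors through the other rows. -/
theorem HasDependentRow.exists_factor {n m : ℕ} {B : TMat n m} (hB : HasDependentRow B) :
    ∃ (X : TMat n (n - 1)) (Y : TMat (n - 1) m), B = tmul X Y := by
  have hn := hB.pos
  obtain ⟨n, rfl⟩ : ∃ k, n = k + 1 := ⟨n - 1, by omega⟩
  obtain ⟨i, a, hi⟩ := hB
  refine ⟨fun p q => if p = i then a (i.succAbove q) else tone (n + 1) p (i.succAbove q),
    fun q j => B (i.succAbove q) j, ?_⟩
  funext p j
  by_cases hp : p = i
  · subst hp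
    simp only [tmul, if_true, hi]
    have e : univ.erase p = univ.image p.succAbove := by
      rw [Fin.image_succAbove_univ, compl_eq_univ_sdiff, sdiff_singleton_eq_erase]
    rw [e, sup_image]
    rfl
  · obtain ⟨q, rfl⟩ := Fin.exists_succAbove_eq hp
    simp only [tmul, if_neg hp]
    apply le_antisymm
    · exact le_trans (by simp [tone])
        (Finset.le_sup (f := fun k => tone (n + 1) (i.succAbove q) (i.succAbove k) +
          B (i.succAbove k) j) (mem_univ q))
    · refine Finset.sup_le fun k _ => ?_
      rcases eq_or_ne q k with h | h
      · simp [tone, h]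
      · simp [tone, h]

theorem HasDependentRow.scheinRank_lt {n m : ℕ} {B : TMat n m} (hB : HasDependentRow B) :
    scheinRank B < n := by
  have hn := hB.pos
  have : scheinRank B ≤ n - 1 := Nat.sInf_le hB.exists_factor
  omega

theorem HasDependentRow.kapranovRank_lt {n m : ℕ} {B : TMat n m} (hB : HasDependentRow B) :
    kapranovRank B < n := by
  have hn := hB.pos
  obtain ⟨X, Y, rfl⟩ := hB.exists_factor
  have := kapranovRank_tmul_le X Y
  omega

/-! ### Minimal generating sets -/

theorem mem_tropHull_iff {ι : Type} [Fintype ι] {m : ℕ} {x : ι → Fin m → T} {y : Fin m → T} :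
    y ∈ tropHull x ↔ ∃ a : ι → T, ∀ j, y j = univ.sup fun i => a i + x i j := by
  constructor
  · rintro ⟨a, rfl⟩
    exact ⟨a, fun j => sup_smulVec_apply _ _ _ _⟩
  · rintro ⟨a, h⟩
    exact ⟨a, funext fun j => (h j).trans (sup_smulVec_apply _ _ _ _).symm⟩

theorem self_mem_tropHull {ι : Type} [Fintype ι] {m : ℕ} (x : ι → Fin m → T) (i : ι) :
    x i ∈ tropHull x := by
  classical
  refine mem_tropHull_iff.2 ⟨fun k => if k = i then 0 else ⊥, fun j => ?_⟩
  apply le_antisymm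
  · exact le_trans (by simp)
      (Finset.le_sup (f := fun k => (if k = i then (0 : T) else ⊥) + x k j) (mem_univ i))
  · refine Finset.sup_le fun k _ => ?_
    rcases eq_or_ne k i with h | h <;> simp [h]

theorem tropHull_subset {ι κ : Type} [Fintype ι] [Fintype κ] {m : ℕ} {x : ι → Fin m → T}
    {y : κ → Fin m → T} (h : ∀ i, x i ∈ tropHull y) : tropHull x ⊆ tropHull y := by
  intro z hz
  simp only [mem_tropHull_iff] at h hz ⊢
  obtain ⟨a, ha⟩ := hz
  choose b hb using h
  refine ⟨fun k => univ.sup fun i => a i + b i k, fun j => ?_⟩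
  rw [ha]
  simp only [hb, add_finset_sup, finset_sup_add]
  rw [Finset.sup_comm]
  simp only [add_assoc]

/-- Also ensures that the infimum in `weakDim` is over a nonempty set and is not the default `0`. -/
theorem exists_minimal_generates {m : ℕ} {X : Set (Fin m → T)} {G₀ : Finset (Fin m → T)}
    (h : Generates X G₀) : ∃ G, Minimal (Generates X) G ∧ G.card ≤ G₀.card := by
  obtain ⟨G, hG, hmin⟩ := exists_minimal_le_of_wellFoundedLT (Generates X) G₀ h
  exact ⟨G, hmin, card_le_card hG⟩

theorem generates_of_mem {n m : ℕ} (B : TMat n m) (G : Finset (Fin m → T))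
    (h₁ : ∀ g ∈ G, g ∈ tropHull fun i : Fin n => B i)
    (h₂ : ∀ i, B i ∈ tropHull fun k : {k // k ∈ G} => k.1) :
    Generates (tropHull fun i : Fin n => B i) G :=
  Set.Subset.antisymm (tropHull_subset fun k => h₁ k.1 k.2) (tropHull_subset h₂)

theorem bot_mem_tropHull {ι : Type} [Fintype ι] {m : ℕ} (x : ι → Fin m → T) :
    ⊥ ∈ tropHull x :=
  mem_tropHull_iff.2 ⟨fun _ => ⊥, fun j => by simp⟩

theorem HasDependentRow.rowRank_lt {n m : ℕ} {B : TMat n m} (hB : HasDependentRow B) :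
    rowRank B < n := by
  have hn := hB.pos
  obtain ⟨i, a, hi⟩ := hB
  set G₀ : Finset (Fin m → T) := (univ.erase i).image fun k => B k with hG₀
  have hgen : Generates (tropHull fun i : Fin n => B i) G₀ := by
    have hmem : ∀ k, k ≠ i → B k ∈ tropHull fun k : {k // k ∈ G₀} => k.1 := fun k hk =>
      self_mem_tropHull (fun k : {k // k ∈ G₀} => k.1)
        ⟨B k, mem_image_of_mem _ (mem_erase.2 ⟨hk, mem_univ k⟩)⟩
    refine generates_of_mem B _ (fun g hg => ?_) fun k => ?_
    · obtain ⟨k, -, rfl⟩ := mem_image.1 hg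
      exact self_mem_tropHull (fun i : Fin n => B i) k
    by_cases hk : k = i
    · subst hk
      -- With row `k` replaced by the null vector, `a` can serve as coefficients on the whole of
      -- `Fin n`, whatever `a k` is.
      have h1 : tropHull (fun l : Fin n => if l = k then ⊥ else B l) ⊆
          tropHull fun k : {k // k ∈ G₀} => k.1 := by
        refine tropHull_subset fun l => ?_
        by_cases hl : l = k
        · rw [if_pos hl]
          exact bot_mem_tropHull _
        · rw [if_neg hl]
          exact hmem l hl
      apply h1
      refine mem_tropHull_iff.2 ⟨a, fun j => ?_⟩
      rw [hi, ← insert_erase (mem_univ k), sup_insert, if_pos rfl, erase_insert_eq_erase]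
      rw [Pi.bot_apply, WithBot.add_bot, bot_sup_eq, erase_idem]
      exact sup_congr rfl fun l hl => by rw [if_neg (mem_erase.1 hl).1]
    · exact hmem k hk
  obtain ⟨G, hG, hcard⟩ := exists_minimal_generates hgen
  have h1 : rowRank B ≤ G.card := Nat.sInf_le ⟨G, hG, rfl⟩
  have h2 : G₀.card ≤ n - 1 := card_image_le.trans (by simp)
  omega

theorem rk_lt_of_dependent {n : ℕ} {B : TMat n n} (hr : HasDependentRow B)
    (hc : HasDependentRow B.transpose) (s : RankNotion) : rk s B < n := by
  cases s with
  | tropical => exact hr.tropicalRank_lt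
  | symmetrized => exact hr.symmetrizedRank_lt
  | gondranMinouxRow => exact hr.gmRowRank_lt
  | gondranMinouxColumn => exact hc.gmRowRank_lt
  | kapranov => exact hr.kapranovRank_lt
  | schein => exact hr.scheinRank_lt
  | row => exact hr.rowRank_lt
  | column => exact hc.rowRank_lt

/-! ### Ranks of matrices with a strictly optimal permutation -/

theorem permWeight_transpose {n : ℕ} (B : TMat n n) (σ : Equiv.Perm (Fin n)) :
    permWeight B.transpose σ = permWeight B σ⁻¹ := by
  rw [permWeight, permWeight, ← Equiv.sum_comp σ fun i => B i (σ⁻¹ i)]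
  simp

theorem IsStrictMax.transpose {n : ℕ} {B : TMat n n} {θ : Equiv.Perm (Fin n)}
    (h : IsStrictMax B θ) : IsStrictMax B.transpose θ⁻¹ := by
  refine ⟨by simpa [permWeight_transpose] using h.1, fun σ hσ => ?_⟩
  rw [permWeight_transpose, permWeight_transpose, inv_inv]
  exact h.2 _ fun e => hσ (by rw [← e, inv_inv])

theorem IsStrictMax.ne_bot {n : ℕ} {B : TMat n n} {θ : Equiv.Perm (Fin n)}
    (h : IsStrictMax B θ) (i : Fin n) : B i (θ i) ≠ ⊥ :=
  fun h0 => h.1 (permWeight_eq_bot h0)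

theorem IsStrictMax.per_eq {n : ℕ} {B : TMat n n} {θ : Equiv.Perm (Fin n)}
    (h : IsStrictMax B θ) : per B = permWeight B θ := by
  refine le_antisymm (Finset.sup_le fun σ _ => ?_) (permWeight_le_per B θ)
  rcases eq_or_ne σ θ with rfl | hσ
  · exact le_rfl
  · exact (h.2 σ hσ).le

theorem IsStrictMax.isUniqueMaximizer {n : ℕ} {B : TMat n n} {θ : Equiv.Perm (Fin n)}
    (h : IsStrictMax B θ) : IsUniqueMaximizer B θ := by
  intro σ
  rw [h.per_eq]
  refine ⟨fun he => ?_, fun he => he ▸ rfl⟩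
  by_contra hσ
  exact (h.2 σ hσ).ne he

theorem IsStrictMax.nonsingular {n : ℕ} {B : TMat n n} {θ : Equiv.Perm (Fin n)}
    (h : IsStrictMax B θ) : Nonsingular B := by
  rintro (⟨hn, h0⟩ | ⟨σ, τ, hne, hσ, hτ⟩)
  · subst hn
    exact h.ne_bot 0 (by rw [h0]; rfl)
  · exact hne (((h.isUniqueMaximizer σ).1 hσ).trans ((h.isUniqueMaximizer τ).1 hτ).symm)

/-- `θ` has only one parity, and all permutations of the other parity weigh strictly less. -/
theorem IsStrictMax.detPlus_ne {n : ℕ} {B : TMat n n} {θ : Equiv.Perm (Fin n)}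
    (h : IsStrictMax B θ) : detPlus B ≠ detMinus B := by
  have hlt : ∀ e : ℤˣ, Equiv.Perm.sign θ ≠ e →
      ((univ.filter fun σ : Equiv.Perm (Fin n) => Equiv.Perm.sign σ = e).sup
        fun σ => permWeight B σ) < permWeight B θ := by
    intro e he
    rw [Finset.sup_lt_iff (bot_lt_iff_ne_bot.2 h.1)]
    intro σ hσ
    refine h.2 σ fun e' => he ?_
    rw [← e']
    exact (mem_filter.1 hσ).2
  have hle : ∀ e : ℤˣ, Equiv.Perm.sign θ = e → permWeight B θ ≤
      ((univ.filter fun σ : Equiv.Perm (Fin n) => Equiv.Perm.sign σ = e).sup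
        fun σ => permWeight B σ) := fun e he =>
    Finset.le_sup (f := fun σ => permWeight B σ) (mem_filter.2 ⟨mem_univ θ, he⟩)
  rcases Int.units_eq_one_or (Equiv.Perm.sign θ) with hs | hs
  · exact ((hlt (-1) (by rw [hs]; decide)).trans_le (hle 1 hs)).ne'
  · exact ((hlt 1 (by rw [hs]; decide)).trans_le (hle (-1) hs)).ne

theorem IsStrictMax.tropicalRank_eq {n : ℕ} {B : TMat n n} {θ : Equiv.Perm (Fin n)}
    (h : IsStrictMax B θ) : tropicalRank B = n :=
  sSup_eq_of_le (fun _ ⟨f, _⟩ => le_of_orderEmbedding f)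
    ⟨RelEmbedding.refl _, RelEmbedding.refl _, h.nonsingular⟩

theorem IsStrictMax.symmetrizedRank_eq {n : ℕ} {B : TMat n n} {θ : Equiv.Perm (Fin n)}
    (h : IsStrictMax B θ) : symmetrizedRank B = n :=
  sSup_eq_of_le (fun _ ⟨f, _⟩ => le_of_orderEmbedding f)
    ⟨RelEmbedding.refl _, RelEmbedding.refl _, h.detPlus_ne⟩

/-- A map of a nonempty finite set into itself without fixed points acts as a nontrivial
permutation on its periodic points. -/
theorem exists_perm_of_map {n : ℕ} (S : Set (Fin n)) (hS : S.Nonempty) (f : Fin n → Fin n)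
    (hf : ∀ i ∈ S, f i ∈ S ∧ f i ≠ i) :
    ∃ π : Equiv.Perm (Fin n), π ≠ 1 ∧ ∀ i, π i = i ∨ i ∈ S ∧ π i = f i := by
  classical
  set P := Function.periodicPts f ∩ S with hP
  have hmaps : ∀ i ∈ P, f i ∈ P := fun i hi =>
    ⟨(Function.bijOn_periodicPts f).mapsTo hi.1, (hf i hi.2).1⟩
  let p : Fin n → Fin n := fun i => if i ∈ P then f i else i
  have hinj : Function.Injective p := by
    intro i j hij
    simp only [p] at hij
    split_ifs at hij with hi hj hj
    · exact (Function.bijOn_periodicPts f).injOn hi.1 hj.1 hij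
    · exact absurd (hij ▸ hmaps i hi) hj
    · exact absurd (hij ▸ hmaps j hj) hi
    · exact hij
  refine ⟨Equiv.ofBijective p (Finite.injective_iff_bijective.1 hinj), fun h1 => ?_, fun i => ?_⟩
  · obtain ⟨i, hi⟩ := hS
    -- The orbit of a point of `S` stays in `S` and repeats; the point at the earlier of two
    -- coinciding times is periodic, and `f` moves it.
    obtain ⟨a, b, hab, he⟩ := Finite.exists_ne_map_eq_of_infinite fun k : ℕ => f^[k] i
    wlog hlt : a < b generalizing a b
    · exact this b a hab.symm he.symm (lt_of_le_of_ne (not_lt.1 hlt) hab.symm)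
    have hmem : f^[a] i ∈ S := by
      clear he hab hlt
      induction a with
      | zero => exact hi
      | succ a ih => rw [Function.iterate_succ_apply']; exact (hf _ ih).1
    have hper : f^[a] i ∈ P := by
      refine ⟨⟨b - a, by omega, ?_⟩, hmem⟩
      rw [Function.IsPeriodicPt, Function.IsFixedPt, ← Function.iterate_add_apply,
        Nat.sub_add_cancel hlt.le]
      exact he.symm
    have := congrArg (fun e : Equiv.Perm (Fin n) => e (f^[a] i)) h1
    simp only [Equiv.ofBijective_apply, Equiv.Perm.one_apply, p, if_pos hper] at this
    exact (hf _ hmem).2 this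
  · simp only [Equiv.ofBijective_apply, p]
    split_ifs with hi
    · exact Or.inr ⟨hi.2, rfl⟩
    · exact Or.inl rfl

/-- Exchanging rows along a cycle cannot keep the weight of a strictly optimal permutation. -/
theorem IsStrictMax.false_of_exchange {n : ℕ} {B : TMat n n} {θ : Equiv.Perm (Fin n)}
    (h : IsStrictMax B θ) (S : Set (Fin n)) (hS : S.Nonempty) (α : Fin n → ℝ)
    (f : Fin n → Fin n) (hf : ∀ i ∈ S, f i ∈ S ∧ f i ≠ i)
    (hle : ∀ i ∈ S, (α i : T) + B i (θ i) ≤ (α (f i) : T) + B (f i) (θ i)) : False := by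
  obtain ⟨π, hπ, hπf⟩ := exists_perm_of_map S hS f hf
  have hσ : θ * π⁻¹ ≠ θ := fun e => hπ (by simpa using e)
  have hw : permWeight B (θ * π⁻¹) = ∑ i, B (π i) (θ i) := by
    rw [permWeight, ← Equiv.sum_comp π]
    simp
  -- Both sides contain the same finite total of the `α i`; cancelling it leaves `θ * π⁻¹` at least
  -- as heavy as `θ`.
  have hsum : ∑ i, ((α i : T) + B i (θ i)) ≤ ∑ i, ((α (π i) : T) + B (π i) (θ i)) := by
    refine sum_le_sum fun i _ => ?_
    rcases hπf i with hi | ⟨hi, hi'⟩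
    · rw [hi]
    · rw [hi']
      exact hle i hi
  rw [sum_add_distrib, sum_add_distrib, Equiv.sum_comp π fun i => (α i : T), ← hw] at hsum
  have hne : ∑ i, (α i : T) ≠ ⊥ := by
    rw [Ne, WithBot.sum_eq_bot_iff]
    rintro ⟨i, -, hi⟩
    exact WithBot.coe_ne_bot hi
  have := WithBot.le_of_add_le_add_left hne hsum
  exact absurd (h.2 _ hσ) (not_lt.2 this)

/-- In a relation between `I` and `J`, read in column `θ i`, the finite term of `i` is dominated by
a term `k` of the opposite side. Sending `i` to `k` preserves the set of indices with finite
coefficients and, by disjointness, has no fixed point there: the exchange lemma applies. -/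
theorem IsStrictMax.gmIndependent {n : ℕ} {B : TMat n n} {θ : Equiv.Perm (Fin n)}
    (h : IsStrictMax B θ) : GMIndependent fun i => B i := by
  rintro I J a hIJ ⟨i₀, hi₀, ha₀⟩ heq
  have heq' : ∀ j, (I.sup fun i => a i + B i j) = J.sup fun i => a i + B i j := fun j => by
    rw [← sup_smulVec_apply I a (fun i => B i), ← sup_smulVec_apply J a (fun i => B i), heq]
  have hlem : ∀ U V : Finset (Fin n), Disjoint U V →
      (∀ j, (U.sup fun i => a i + B i j) = V.sup fun i => a i + B i j) → ∀ i ∈ U, a i ≠ ⊥ →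
      ∃ k ∈ V, k ≠ i ∧ a k ≠ ⊥ ∧ a i + B i (θ i) ≤ a k + B k (θ i) := by
    intro U V hUV hj i hi hai
    have h1 : a i + B i (θ i) ≤ V.sup fun k => a k + B k (θ i) := by
      rw [← hj]
      exact Finset.le_sup (f := fun k => a k + B k (θ i)) hi
    have h2 : a i + B i (θ i) ≠ ⊥ := WithBot.add_ne_bot.2 ⟨hai, h.ne_bot i⟩
    have hne : V.Nonempty := by
      rw [nonempty_iff_ne_empty]
      rintro rfl
      exact h2 (by simpa using h1)
    obtain ⟨k, hk, hk'⟩ := exists_mem_eq_sup V hne fun k => a k + B k (θ i)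
    rw [hk'] at h1
    refine ⟨k, hk, ?_, ?_, h1⟩
    · rintro rfl
      exact disjoint_left.1 hUV hi hk
    · intro h0
      rw [h0, WithBot.bot_add, le_bot_iff] at h1
      exact h2 h1
  have hall : ∀ i, ∃ k, i ∈ {i | i ∈ I ∪ J ∧ a i ≠ ⊥} →
      k ∈ {i | i ∈ I ∪ J ∧ a i ≠ ⊥} ∧ k ≠ i ∧ a i + B i (θ i) ≤ a k + B k (θ i) := by
    intro i
    by_cases hi : i ∈ {i | i ∈ I ∪ J ∧ a i ≠ ⊥}
    · obtain ⟨hi1, hi2⟩ := hi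
      rcases mem_union.1 hi1 with hI | hJ
      · obtain ⟨k, hk, h1, h2, h3⟩ := hlem I J hIJ heq' i hI hi2
        exact ⟨k, fun _ => ⟨⟨mem_union_right _ hk, h2⟩, h1, h3⟩⟩
      · obtain ⟨k, hk, h1, h2, h3⟩ := hlem J I hIJ.symm (fun j => (heq' j).symm) i hJ hi2
        exact ⟨k, fun _ => ⟨⟨mem_union_left _ hk, h2⟩, h1, h3⟩⟩
    · exact ⟨i, fun h => absurd h hi⟩
  choose f hf using hall
  have hα : ∀ i, a i ≠ ⊥ → (((a i).unbotD 0 : ℝ) : T) = a i := by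
    intro i hi
    obtain ⟨c, hc⟩ := WithBot.ne_bot_iff_exists.1 hi
    rw [← hc]
    rfl
  refine h.false_of_exchange {i | i ∈ I ∪ J ∧ a i ≠ ⊥} ⟨i₀, hi₀, ha₀⟩ (fun i => (a i).unbotD 0) f
    (fun i hi => ⟨(hf i hi).1, (hf i hi).2.1⟩) fun i hi => ?_
  rw [hα i hi.2, hα (f i) (hf i hi).1.2]
  exact (hf i hi).2.2

theorem IsStrictMax.gmRowRank_eq {n : ℕ} {B : TMat n n} {θ : Equiv.Perm (Fin n)}
    (h : IsStrictMax B θ) : gmRowRank B = n :=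
  sSup_eq_of_le (fun _ ⟨f, _⟩ => le_of_orderEmbedding f) ⟨RelEmbedding.refl _, h.gmIndependent⟩

theorem val_units_smul (e : ℤˣ) (x : K) : val (e • x) = val x := by
  rcases Int.units_eq_one_or e with rfl | rfl
  · simp
  · rw [Units.neg_smul, one_smul, val_neg]

/-- The determinant of a lift does not vanish: the dominant term is not cancelled. -/
theorem IsStrictMax.det_ne_zero {n : ℕ} {B : TMat n n} {θ : Equiv.Perm (Fin n)}
    (h : IsStrictMax B θ) (M : Matrix (Fin n) (Fin n) K) (hM : ∀ i j, val (M j i) = B i j) :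
    M.det ≠ 0 := by
  have hval : ∀ σ : Equiv.Perm (Fin n),
      val (Equiv.Perm.sign σ • ∏ i, M (σ i) i) = permWeight B σ := by
    intro σ
    rw [val_units_smul, val_prod, permWeight]
    simp only [hM]
  obtain ⟨c, hc⟩ := WithBot.ne_bot_iff_exists.1 h.1
  intro h0
  rw [Matrix.det_apply] at h0
  -- At the exponent `-c`, with `c` the weight of `θ`, all other terms of the Leibniz expansion have
  -- zero coefficient.
  have h1 := congrArg (fun x : K => x.coeff (-c)) h0
  simp only [HahnSeries.coeff_sum, HahnSeries.coeff_zero] at h1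
  rw [sum_eq_single θ] at h1
  · exact coeff_ne_zero_of_val_eq ((hval θ).trans hc.symm) h1
  · intro σ _ hσ
    refine coeff_eq_zero_of_val_lt ?_
    rw [hval, hc]
    exact h.2 σ hσ
  · exact fun h => absurd (mem_univ θ) h

/-- Vectors of `W` lifting the columns form a matrix with nonzero determinant, hence are
independent. -/
theorem IsStrictMax.le_finrank {n : ℕ} {B : TMat n n} {θ : Equiv.Perm (Fin n)}
    (h : IsStrictMax B θ) (W : Submodule K (Fin n → K))
    (hW : ∀ j, B.transpose j ∈ tropLinear W) : n ≤ Module.finrank K W := by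
  choose x hxW hx using hW
  have hdet := h.det_ne_zero (Matrix.of x) fun i j => congrFun (hx j) i
  have hli : LinearIndependent K x := Matrix.linearIndependent_rows_of_det_ne_zero hdet
  have hli' : LinearIndependent K fun j => (⟨x j, hxW j⟩ : W) :=
    LinearIndependent.of_comp W.subtype hli
  simpa using hli'.fintype_card_le_finrank

theorem IsStrictMax.le_of_factor {n r : ℕ} {B : TMat n n} {θ : Equiv.Perm (Fin n)}
    (h : IsStrictMax B θ) (X : TMat n r) (Y : TMat r n) (he : B = tmul X Y) : n ≤ r := by
  obtain ⟨W, hW, hc⟩ := exists_tropLinear_of_tmul X Y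
  rw [← he] at hc
  exact (h.le_finrank W hc).trans hW

theorem IsStrictMax.kapranovRank_eq {n : ℕ} {B : TMat n n} {θ : Equiv.Perm (Fin n)}
    (h : IsStrictMax B θ) : kapranovRank B = n := by
  apply le_antisymm
  · simpa [tmul_tone] using kapranovRank_tmul_le B (tone n)
  · obtain ⟨W, -, hc⟩ := exists_tropLinear_of_tmul B (tone n)
    rw [tmul_tone] at hc
    refine le_csInf ⟨_, W, rfl, hc⟩ ?_
    rintro d ⟨W, rfl, hW⟩
    exact h.le_finrank W hW

theorem IsStrictMax.scheinRank_eq {n : ℕ} {B : TMat n n} {θ : Equiv.Perm (Fin n)}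
    (h : IsStrictMax B θ) : scheinRank B = n := by
  have hn : ∃ (X : TMat n n) (Y : TMat n n), B = tmul X Y := ⟨B, tone n, (tmul_tone B).symm⟩
  refine le_antisymm (Nat.sInf_le hn) (le_csInf ⟨n, hn⟩ ?_)
  rintro r ⟨X, Y, he⟩
  exact h.le_of_factor X Y he

/-- Bounds the row rank below by the Schein rank: the generators are the rows of the right factor.
-/
theorem exists_factor_of_generates {n m : ℕ} {B : TMat n m} {G : Finset (Fin m → T)}
    (hG : Generates (tropHull fun i : Fin n => B i) G) :
    ∃ (X : TMat n G.card) (Y : TMat G.card m), B = tmul X Y := by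
  have hmem : ∀ i, B i ∈ tropHull fun k : {k // k ∈ G} => k.1 := fun i => by
    have hG' : tropHull (fun k : {k // k ∈ G} => k.1) = _ := hG
    rw [hG']
    exact self_mem_tropHull (fun i : Fin n => B i) i
  simp only [mem_tropHull_iff] at hmem
  choose a ha using hmem
  let X : TMat n G.card := fun i k => a i (G.equivFin.symm k)
  let Y : TMat G.card m := fun k => (G.equivFin.symm k).1
  refine ⟨X, Y, funext fun i => funext fun j => (ha i j).trans (le_antisymm ?_ ?_)⟩
  · refine Finset.sup_le fun k _ => ?_
    have := le_tmul X Y i (G.equivFin k) j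
    simpa [X, Y] using this
  · exact tmul_le_iff.2 fun k =>
      Finset.le_sup (f := fun l : {k // k ∈ G} => a i l + l.1 j) (mem_univ (G.equivFin.symm k))

theorem IsStrictMax.rowRank_eq {n : ℕ} {B : TMat n n} {θ : Equiv.Perm (Fin n)}
    (h : IsStrictMax B θ) : rowRank B = n := by
  have hgen : Generates (tropHull fun i : Fin n => B i) (univ.image fun k => B k) := by
    refine generates_of_mem B _ (fun g hg => ?_) fun i => ?_
    · obtain ⟨k, -, rfl⟩ := mem_image.1 hg
      exact self_mem_tropHull (fun i : Fin n => B i) k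
    · exact self_mem_tropHull (fun k : {k // k ∈ univ.image fun k => B k} => k.1)
        ⟨B i, mem_image_of_mem _ (mem_univ i)⟩
  obtain ⟨G, hG, hcard⟩ := exists_minimal_generates hgen
  apply le_antisymm
  · have h1 : rowRank B ≤ G.card := Nat.sInf_le ⟨G, hG, rfl⟩
    exact h1.trans (hcard.trans (card_image_le.trans (by simp)))
  · refine le_csInf ⟨_, G, hG, rfl⟩ ?_
    rintro _ ⟨G', hG', rfl⟩
    obtain ⟨X, Y, he⟩ := exists_factor_of_generates hG'.1
    exact h.le_of_factor X Y he

theorem IsStrictMax.rk_eq {n : ℕ} {B : TMat n n} {θ : Equiv.Perm (Fin n)}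
    (h : IsStrictMax B θ) (s : RankNotion) : rk s B = n := by
  cases s with
  | tropical => exact h.tropicalRank_eq
  | symmetrized => exact h.symmetrizedRank_eq
  | gondranMinouxRow => exact h.gmRowRank_eq
  | gondranMinouxColumn => exact h.transpose.gmRowRank_eq
  | kapranov => exact h.kapranovRank_eq
  | schein => exact h.scheinRank_eq
  | row => exact h.rowRank_eq
  | column => exact h.transpose.rowRank_eq

/-! ### Limits of powers -/

theorem continuous_const_add (c : T) : Continuous fun x : T => c + x := by
  cases c using WithBot.recBotCoe with
  | bot => simpa using continuous_const
  | coe c =>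
    let e : T ≃o T :=
      { toFun := fun x => (c : T) + x
        invFun := fun x => ((-c : ℝ) : T) + x
        left_inv := fun x => by simp only [← add_assoc, ← WithBot.coe_add]; simp
        right_inv := fun x => by simp only [← add_assoc, ← WithBot.coe_add]; simp
        map_rel_iff' := by
          intro x y
          exact WithBot.add_le_add_iff_left WithBot.coe_ne_bot }
    exact e.continuous

theorem continuous_add_const (c : T) : Continuous fun x : T => x + c := by
  simpa only [add_comm _ c] using continuous_const_add c

/-- If `B p q` is finite, the non-null members `M` of the class are cut out by the closed equations
`M i j + B p q = B i j + M p q`. The null class has empty preimage among the non-null matrices. -/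
theorem isClosed_singleton_proj {n m : ℕ} (B : TMat n m) : IsClosed {proj B} := by
  rw [isClosed_coinduced]
  by_cases hB : B = nullMat n m
  · have : (fun A : {A : TMat n m // A ≠ nullMat n m} => proj A.1) ⁻¹' {proj B} = ∅ := by
      rw [Set.eq_empty_iff_forall_notMem]
      rintro ⟨M, hM⟩ h
      obtain ⟨c, hc⟩ := Quotient.exact (s := projSetoid n m) h
      apply hM
      rw [hB] at hc
      funext i j
      have := congrFun (congrFun hc i) j
      simpa [smulMat, nullMat] using this.symm
    rw [this]
    exact @isClosed_empty _ _
  · obtain ⟨p, q, hpq⟩ : ∃ p q, B p q ≠ ⊥ := by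
      by_contra! h
      exact hB (funext fun i => funext fun j => h i j)
    obtain ⟨b, hb⟩ := WithBot.ne_bot_iff_exists.1 hpq
    have : (fun A : {A : TMat n m // A ≠ nullMat n m} => proj A.1) ⁻¹' {proj B} =
        ⋂ i, ⋂ j, {M | M.1 i j + B p q = B i j + M.1 p q} := by
      ext ⟨M, hM⟩
      simp only [Set.mem_preimage, Set.mem_singleton_iff, Set.mem_iInter, Set.mem_ofPred_eq]
      constructor
      · intro h i j
        obtain ⟨c, hc⟩ := Quotient.exact (s := projSetoid n m) h
        rw [hc]
        simp only [smulMat]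
        rw [add_comm, add_right_comm]
      · intro h
        have hM' : M p q ≠ ⊥ := by
          intro h0
          apply hM
          funext i j
          have := h i j
          rw [h0, ← hb, WithBot.add_bot, WithBot.add_coe_eq_bot_iff] at this
          exact this
        obtain ⟨a, ha⟩ := WithBot.ne_bot_iff_exists.1 hM'
        refine Quotient.sound (s := projSetoid n m) ⟨b - a, funext fun i => funext fun j => ?_⟩
        have := h i j
        rw [← ha, ← hb] at this
        rw [add_comm (B i j), add_comm (M i j)] at this
        rw [smulMat]
        cases hx : M i j using WithBot.recBotCoe with
        | bot =>
          rw [hx, WithBot.add_bot, eq_comm, WithBot.coe_add_eq_bot_iff] at this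
          simp [this]
        | coe x =>
          cases hy : B i j using WithBot.recBotCoe with
          | bot => simp [hx, hy, ← WithBot.coe_add] at this
          | coe y =>
            rw [hx, hy] at this
            norm_cast at this ⊢
            linarith
    rw [this]
    refine isClosed_iInter fun i => isClosed_iInter fun j => ?_
    have hc : ∀ i j, Continuous fun M : {A : TMat n m // A ≠ nullMat n m} => M.1 i j :=
      fun i j => (continuous_apply j).comp ((continuous_apply i).comp continuous_subtype_val)
    exact isClosed_eq ((continuous_add_const _).comp (hc i j))
      ((continuous_const_add _).comp (hc p q))

instance (n m : ℕ) : T1Space (ProjMat n m) :=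
  ⟨fun x => Quotient.inductionOn x fun B => isClosed_singleton_proj B⟩

/-- The sequence and its limit must avoid the null matrix, since the quotient topology comes from
the non-null matrices. -/
theorem proj_mem_closProj_of_tendsto {n : ℕ} {A Q : TMat n n} {M : ℕ → TMat n n} {k : ℕ → ℕ}
    (hM : ∀ m, proj (M m) = proj (tpow A (k m))) (h0 : ∀ m, M m ≠ nullMat n n)
    (hQ : Q ≠ nullMat n n)
    (h : ∀ i j, Tendsto (fun m => M m i j) atTop (𝓝 (Q i j))) : proj Q ∈ closProj A := by
  have hc : Continuous fun M : {A : TMat n n // A ≠ nullMat n n} => proj M.1 :=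
    continuous_coinduced_rng
  have ht : Tendsto (fun m => (⟨M m, h0 m⟩ : {A : TMat n n // A ≠ nullMat n n})) atTop
      (𝓝 ⟨Q, hQ⟩) := by
    rw [tendsto_subtype_rng]
    exact tendsto_pi_nhds.2 fun i => tendsto_pi_nhds.2 fun j => h i j
  refine mem_closure_of_tendsto ((hc.tendsto _).comp ht) (Eventually.of_forall fun m => ?_)
  exact ⟨k m, (hM m).symm⟩

/-- In each stretch of `n` steps, a walk through nodes that belong to no circuit of weight `0`
loses a fixed amount. -/
theorem walkWeight_le_of_avoid {n : ℕ} {C : TMat n n} (hC : ∀ i j, C i j ≤ 0) {Z : Set (Fin n)}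
    {δ : ℝ} (hδ : ∀ i, i ∉ Z → ∀ k, 1 ≤ k → k ≤ n → tpow C k i i ≤ ((-δ : ℝ) : T))
    (w : ℕ → Fin n) (q : ℕ) (hw : ∀ t ≤ n * q, w t ∉ Z) :
    walkWeight C w 0 (n * q) ≤ ((-(q * δ) : ℝ) : T) := by
  induction q with
  | zero => simp [walkWeight]
  | succ q ih =>
    have ih' := ih fun t ht => hw t (ht.trans (Nat.mul_le_mul_left n (Nat.le_succ q)))
    obtain ⟨a, b, ha, hab, hb, he⟩ := exists_repeat w (n * q)
    rw [← Nat.mul_succ, Nat.succ_eq_add_one] at hb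
    have hle : ∀ s t, walkWeight C w s t ≤ 0 := fun s t => sum_nonpos fun _ _ => hC _ _
    have h1 : walkWeight C w a b ≤ ((-δ : ℝ) : T) := by
      refine (walkWeight_le_tpow_sub C w hab.le).trans ?_
      rw [← he]
      refine hδ _ (hw a (by omega)) _ (by omega) ?_
      rw [Nat.mul_succ] at hb
      omega
    rw [← walkWeight_add C w (Nat.zero_le (n * q)) (ha.trans (hab.le.trans hb)),
      ← walkWeight_add C w ha (hab.le.trans hb), ← walkWeight_add C w hab.le hb]
    calc _ ≤ ((-(q * δ) : ℝ) : T) + (0 + (((-δ : ℝ) : T) + 0)) :=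
          add_le_add ih' (add_le_add (hle _ _) (add_le_add h1 (hle _ _)))
      _ = _ := by
          rw [zero_add, add_zero, ← WithBot.coe_add]
          congr 1
          push_cast
          ring

open Classical in
/-- The limit of the powers of a matrix with nonpositive entries, where `Z` is the set of the nodes
with a loop of weight `0`. -/
def limitMat {n : ℕ} (C : TMat n n) (Z : Set (Fin n)) : TMat n n :=
  fun i j => (univ.filter (· ∈ Z)).sup fun c => tpow C n i c + tpow C n c j

theorem limitMat_of_mem_right {n : ℕ} {C : TMat n n} (hC : ∀ i j, C i j ≤ 0) {Z : Set (Fin n)}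
    (hZ : ∀ c ∈ Z, C c c = 0) {c : Fin n} (hc : c ∈ Z) (i : Fin n) :
    limitMat C Z i c = tpow C n i c := by
  classical
  apply le_antisymm
  · exact Finset.sup_le fun d _ => (le_tpow_add C n n i d c).trans (tpow_col_le hC (hZ c hc) i _)
  · have h0 : tpow C n c c = 0 := by
      refine le_antisymm (tpow_nonpos hC _ _ _) ?_
      rw [← tpow_zero_diag C c]
      exact tpow_col_mono (hZ c hc) c (Nat.zero_le n)
    have := Finset.le_sup (f := fun d => tpow C n i d + tpow C n d c)
      (mem_filter.2 ⟨mem_univ c, hc⟩ : c ∈ univ.filter (· ∈ Z))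
    simp only [h0, add_zero] at this
    exact this

theorem limitMat_of_mem_left {n : ℕ} {C : TMat n n} (hC : ∀ i j, C i j ≤ 0) {Z : Set (Fin n)}
    (hZ : ∀ c ∈ Z, C c c = 0) {c : Fin n} (hc : c ∈ Z) (j : Fin n) :
    limitMat C Z c j = tpow C n c j := by
  classical
  apply le_antisymm
  · exact Finset.sup_le fun d _ => (le_tpow_add C n n c d j).trans (tpow_row_le hC (hZ c hc) j _)
  · have h0 : tpow C n c c = 0 := by
      refine le_antisymm (tpow_nonpos hC _ _ _) ?_
      rw [← tpow_zero_diag C c]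
      exact tpow_col_mono (hZ c hc) c (Nat.zero_le n)
    have := Finset.le_sup (f := fun d => tpow C n c d + tpow C n d j)
      (mem_filter.2 ⟨mem_univ c, hc⟩ : c ∈ univ.filter (· ∈ Z))
    simp only [h0, zero_add] at this
    exact this

/-- Exhibits each row of the limit as a combination of the rows indexed by `Z`, and likewise for
columns. -/
theorem limitMat_eq_sup {n : ℕ} {C : TMat n n} (hC : ∀ i j, C i j ≤ 0) {Z : Set (Fin n)}
    [DecidablePred (· ∈ Z)] (hZ : ∀ c ∈ Z, C c c = 0) (i j : Fin n) :
    limitMat C Z i j =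
      (univ.filter (· ∈ Z)).sup fun c => limitMat C Z i c + limitMat C Z c j := by
  conv_lhs => rw [limitMat]
  refine sup_congr (by ext; simp) fun c hc => ?_
  rw [mem_filter] at hc
  rw [limitMat_of_mem_right hC hZ hc.2, limitMat_of_mem_left hC hZ hc.2]

/-- Finitely many negative entries have a negative maximum; if it is `-∞`, any `δ` will do. -/
theorem exists_gap {n : ℕ} {C : TMat n n} (hC : ∀ i j, C i j ≤ 0) {Z : Set (Fin n)}
    (hnZ : ∀ i, i ∉ Z → ∀ k, 1 ≤ k → tpow C k i i ≠ 0) :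
    ∃ δ : ℝ, 0 < δ ∧ ∀ i, i ∉ Z → ∀ k, 1 ≤ k → k ≤ n → tpow C k i i ≤ ((-δ : ℝ) : T) := by
  classical
  set x : T := (univ.filter (· ∉ Z)).sup fun i => (Icc 1 n).sup fun k => tpow C k i i with hx
  have hlt : x < 0 := by
    rw [hx, Finset.sup_lt_iff (WithBot.bot_lt_coe 0)]
    intro i hi
    rw [Finset.sup_lt_iff (WithBot.bot_lt_coe 0)]
    intro k hk
    exact lt_of_le_of_ne (tpow_nonpos hC k i i)
      (hnZ i (mem_filter.1 hi).2 k (mem_Icc.1 hk).1)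
  have hle : ∀ i, i ∉ Z → ∀ k, 1 ≤ k → k ≤ n → tpow C k i i ≤ x := fun i hi k hk hkn =>
    le_trans (Finset.le_sup (f := fun k => tpow C k i i) (mem_Icc.2 ⟨hk, hkn⟩))
      (Finset.le_sup (f := fun i => (Icc 1 n).sup fun k => tpow C k i i)
        (mem_filter.2 ⟨mem_univ i, hi⟩))
  cases hy : x using WithBot.recBotCoe with
  | bot => exact ⟨1, one_pos, fun i hi k hk hkn => (hle i hi k hk hkn).trans (by simp [hy])⟩
  | coe y =>
    rw [hy] at hlt
    have hy0 : y < 0 := by exact_mod_cast hlt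
    exact ⟨-y, by linarith, fun i hi k hk hkn => (hle i hi k hk hkn).trans (by simp [hy])⟩

/-- A walk meeting `Z` splits there and is bounded by the limit; one avoiding `Z` loses `δ` every
`n` steps, a bound tending to `-∞`. Conversely, from length `2 * n` on, waiting at a node of `Z`
attains the limit. -/
theorem tendsto_tpow_limitMat {n : ℕ} {C : TMat n n} (hC : ∀ i j, C i j ≤ 0) {Z : Set (Fin n)}
    (hZ : ∀ c ∈ Z, C c c = 0) (hnZ : ∀ i, i ∉ Z → ∀ k, 1 ≤ k → tpow C k i i ≠ 0)
    (i j : Fin n) : Tendsto (fun m => tpow C m i j) atTop (𝓝 (limitMat C Z i j)) := by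
  classical
  obtain ⟨δ, hδ0, hδ⟩ := exists_gap hC hnZ
  have hupper : ∀ m, tpow C m i j ≤
      max (limitMat C Z i j) ((-(((m / n : ℕ) : ℝ) * δ) : ℝ) : T) := by
    intro m
    rcases eq_or_ne (tpow C m i j) ⊥ with h0 | h0
    · simp [h0]
    obtain ⟨w, hw0, hwm, hw⟩ := exists_walk h0
    by_cases hv : ∃ t ≤ m, w t ∈ Z
    · obtain ⟨t, ht, hc⟩ := hv
      apply le_max_of_le_left
      rw [← hw, ← walkWeight_add C w (Nat.zero_le t) ht]
      have h1 := walkWeight_le_tpow_sub C w (Nat.zero_le t)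
      have h2 := walkWeight_le_tpow_sub C w ht
      rw [hw0] at h1
      rw [hwm] at h2
      refine (add_le_add (h1.trans (tpow_col_le hC (hZ _ hc) i _))
        (h2.trans (tpow_row_le hC (hZ _ hc) j _))).trans ?_
      exact Finset.le_sup (f := fun c => tpow C n i c + tpow C n c j)
        (mem_filter.2 ⟨mem_univ (w t), hc⟩)
    · push Not at hv
      apply le_max_of_le_right
      have hq : n * (m / n) ≤ m := Nat.mul_div_le m n
      have h1 := walkWeight_le_of_avoid hC hδ w (m / n) fun t ht => hv t (ht.trans hq)
      rw [← hw, ← walkWeight_add C w (Nat.zero_le _) hq]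
      calc _ ≤ _ + (0 : T) := add_le_add h1 (sum_nonpos fun _ _ => hC _ _)
        _ = _ := add_zero _
  have hlower : ∀ᶠ m in atTop, limitMat C Z i j ≤ tpow C m i j := by
    filter_upwards [eventually_ge_atTop (n + n)] with m hm
    refine Finset.sup_le fun c hc => ?_
    have h1 := tpow_row_mono (hZ c (mem_filter.1 hc).2) j (show n ≤ m - n by omega)
    refine (add_le_add le_rfl h1).trans ((le_tpow_add C n (m - n) i c j).trans_eq ?_)
    rw [Nat.add_sub_cancel' (by omega)]
  have hlim : Tendsto (fun m : ℕ => ((-(((m / n : ℕ) : ℝ) * δ) : ℝ) : T)) atTop (𝓝 ⊥) := by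
    have h := tendsto_neg_atTop_atBot.comp (Tendsto.atTop_mul_const hδ0
      (tendsto_natCast_atTop_atTop.comp (Nat.tendsto_div_const_atTop i.pos.ne')))
    exact (WithBot.tendsto_nhds_bot_iff _).2 fun x =>
      (h.eventually_lt_atBot x).mono fun m hm => WithBot.coe_lt_coe.2 hm
  have hlim' := (tendsto_const_nhds (x := limitMat C Z i j)).max hlim
  rw [max_eq_left bot_le] at hlim'
  exact tendsto_of_tendsto_of_tendsto_of_le_of_le' tendsto_const_nhds hlim' hlower
    (Eventually.of_forall hupper)

/-! ### Dependent rows and diagonal similarity -/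

theorem hasDependentRow_of_sup {n : ℕ} {Q : TMat n n} {i : Fin n} (s : Finset (Fin n))
    (hi : i ∉ s) (b : Fin n → T) (h : ∀ j, Q i j = s.sup fun c => b c + Q c j) :
    HasDependentRow Q := by
  classical
  refine ⟨i, fun c => if c ∈ s then b c else ⊥, fun j => ?_⟩
  rw [h]
  apply le_antisymm
  · refine Finset.sup_le fun c hc => ?_
    have hci : c ∈ univ.erase i := mem_erase.2 ⟨fun e => hi (e ▸ hc), mem_univ c⟩
    have := Finset.le_sup (f := fun c => (if c ∈ s then b c else ⊥) + Q c j) hci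
    simpa only [if_pos hc] using this
  · refine Finset.sup_le fun c _ => ?_
    by_cases hc : c ∈ s
    · simp only [if_pos hc]
      exact Finset.le_sup (f := fun c => b c + Q c j) hc
    · simp only [if_neg hc, WithBot.bot_add]
      exact bot_le

theorem hasDependentRow_of_eq {n : ℕ} {Q : TMat n n} {i k : Fin n} (hik : i ≠ k)
    (h : ∀ j, Q i j = Q k j) : HasDependentRow Q :=
  hasDependentRow_of_sup {k} (by simpa using hik) (fun _ => 0) (by simpa using h)

theorem hasDependentRow_nullMat {n : ℕ} (i : Fin n) : HasDependentRow (nullMat n n) :=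
  hasDependentRow_of_sup (i := i) ∅ (by simp) (fun _ => 0) (by simp [nullMat])

theorem HasDependentRow.normalize {n : ℕ} {Q : TMat n n} (h : HasDependentRow Q)
    (u : Fin n → ℝ) (r : ℝ) : HasDependentRow (normalize Q u r) := by
  obtain ⟨i, a, hi⟩ := h
  refine ⟨i, fun k => a k + ((u k - u i : ℝ) : T), fun j => ?_⟩
  simp only [Tropical53.normalize]
  rw [hi, finset_sup_add]
  refine sup_congr rfl fun k _ => ?_
  rw [add_add_add_comm, ← WithBot.coe_add]
  congr 2
  ring

theorem transpose_normalize {n : ℕ} (Q : TMat n n) (u : Fin n → ℝ) (r : ℝ) :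
    (normalize Q u r).transpose = normalize Q.transpose (-u) r := by
  funext i j
  simp only [normalize, Matrix.transpose_apply, Pi.neg_apply]
  congr 2
  ring

/-- Conjugating back by `-u` leaves only the scalar `k * r`, invisible projectively. -/
theorem proj_tpow_normalize {n : ℕ} (A : TMat n n) (u : Fin n → ℝ) (r : ℝ) (k : ℕ) :
    proj (normalize (tpow (normalize A u r) k) (-u) 0) = proj (tpow A k) := by
  refine Quotient.sound (s := projSetoid n n) ⟨k * r, ?_⟩
  funext i j
  simp only [smulMat]
  rw [add_comm, normalize, tpow_normalize, add_assoc, add_assoc, ← WithBot.coe_add,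
    ← WithBot.coe_add]
  convert (add_zero _).symm
  rw [← WithBot.coe_zero, WithBot.coe_inj]
  simp only [Pi.neg_apply]
  ring

/-! ### Full ultimate rank forces the critical graph to be that of a permutation -/

theorem tpow_mul_diag {n : ℕ} {A : TMat n n} (hA : ∀ i j, A i j ≤ 0) {c : Fin n} {a : ℕ}
    (h : tpow A a c c = 0) (b : ℕ) : tpow A (a * b) c c = 0 := by
  refine le_antisymm (tpow_nonpos hA _ _ _) ?_
  rw [tpow_mul, ← tpow_zero_diag (tpow A a) c]
  exact tpow_col_mono h c (Nat.zero_le b)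

theorem exists_common_period {n : ℕ} {A : TMat n n} (hA : ∀ i j, A i j ≤ 0) {Z : Set (Fin n)}
    (hZ : ∀ c ∈ Z, ∃ m, 1 ≤ m ∧ tpow A m c c = 0) :
    ∃ N, 1 ≤ N ∧ ∀ c ∈ Z, tpow A N c c = 0 := by
  have h : ∀ c, ∃ m, 1 ≤ m ∧ (c ∈ Z → tpow A m c c = 0) := by
    intro c
    by_cases hc : c ∈ Z
    · obtain ⟨m, hm, h⟩ := hZ c hc
      exact ⟨m, hm, fun _ => h⟩
    · exact ⟨1, le_rfl, fun h => absurd h hc⟩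
  choose m hm hmc using h
  refine ⟨∏ c, m c, Nat.one_le_iff_ne_zero.2 (prod_ne_zero_iff.2 fun c _ => by have := hm c; omega),
    fun c hc => ?_⟩
  rw [← mul_prod_erase _ _ (mem_univ c)]
  exact tpow_mul_diag hA (hmc c hc) _

/-- The matrix is the limit of the powers of `C`, conjugated back: its row and column `i` are
combinations of the critical ones. The entry `0` at a critical node `c` keeps the sequence and its
limit away from the null matrix. -/
theorem exists_dependent_of_not_critical {n : ℕ} {A : TMat n n} {r : ℝ} (h : rho A = r)
    {i : Fin n} (hi : i ∉ (criticalGraph A).nodes) :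
    ∃ B, proj B ∈ closProj A ∧ HasDependentRow B ∧ HasDependentRow B.transpose := by
  classical
  obtain ⟨u, hu⟩ := exists_potential h
  set Z := (criticalGraph A).nodes with hZdef
  have hmem := mem_criticalGraph_nodes_iff h hu
  obtain ⟨N, hN, hNZ⟩ := exists_common_period hu (Z := Z) fun c hc => (hmem c).1 hc
  set C := tpow (normalize A u r) N with hCdef
  have hC : ∀ i j, C i j ≤ 0 := tpow_nonpos hu N
  have hnZ : ∀ i, i ∉ Z → ∀ k, 1 ≤ k → tpow C k i i ≠ 0 := by
    intro i hi k hk h0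
    rw [hCdef, ← tpow_mul] at h0
    exact hi ((hmem i).2 ⟨N * k, Nat.mul_pos hN hk, h0⟩)
  have hlim := tendsto_tpow_limitMat hC hNZ hnZ
  obtain ⟨c, hc⟩ := exists_mem_criticalGraph_nodes h
  have hd : ∀ m, tpow C m c c = 0 := fun m => by
    rw [hCdef, ← tpow_mul]
    exact tpow_mul_diag hu (hNZ c hc) m
  have hne : ∀ Q : TMat n n, Q c c = 0 → normalize Q (-u) 0 ≠ nullMat n n := by
    intro Q hQ h0
    have := congrFun (congrFun h0 c) c
    rw [normalize, hQ, zero_add] at this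
    exact WithBot.coe_ne_bot this
  have hsup := limitMat_eq_sup hC hNZ
  have his : i ∉ univ.filter (· ∈ Z) := by simpa using hi
  refine ⟨normalize (limitMat C Z) (-u) 0, ?_, ?_, ?_⟩
  · refine proj_mem_closProj_of_tendsto (M := fun m => normalize (tpow C m) (-u) 0)
      (k := fun m => N * m) (fun m => ?_) (fun m => hne _ (hd m)) (hne _ ?_) fun i j => ?_
    · rw [hCdef, ← tpow_mul, proj_tpow_normalize]
    · rw [limitMat_of_mem_left hC hNZ hc, hd]
    · exact ((continuous_add_const _).tendsto _).comp (hlim i j)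
  · exact (hasDependentRow_of_sup _ his (fun c => limitMat C Z i c) (hsup i)).normalize _ _
  · rw [transpose_normalize]
    refine (hasDependentRow_of_sup _ his (fun c => limitMat C Z c i) fun j => ?_).normalize _ _
    simp only [Matrix.transpose_apply]
    rw [hsup]
    simp only [add_comm]

theorem tpow_mul_eq_zero {n : ℕ} {A : TMat n n} (hA : ∀ i j, A i j ≤ 0) {i j : Fin n} {a b : ℕ}
    (hi : tpow A a i i = 0) (hij : tpow A a i j = 0) (hb : 1 ≤ b) : tpow A (a * b) i j = 0 := by
  refine le_antisymm (tpow_nonpos hA _ _ _) ?_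
  obtain ⟨b, rfl⟩ : ∃ k, b = k + 1 := ⟨b - 1, by omega⟩
  have := le_tpow_add A (a * b) a i i j
  rwa [tpow_mul_diag hA hi, hij, add_zero] at this

/-- From `j` one returns to `i` and then chooses `j` or `k`, at no cost and in the same number of
steps; likewise from `k`. Hence `j` and `k` communicate freely in `C`, and their rows and columns
agree in its stabilized power. -/
theorem exists_dependent_of_two_arcs {n : ℕ} {A : TMat n n} {r : ℝ} (h : rho A = r)
    (hall : ∀ c, c ∈ (criticalGraph A).nodes) {i j k : Fin n} (hjk : j ≠ k)
    (hj : (i, j) ∈ (criticalGraph A).arcs) (hk : (i, k) ∈ (criticalGraph A).arcs) :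
    ∃ B, proj B ∈ closProj A ∧ HasDependentRow B ∧ HasDependentRow B.transpose := by
  obtain ⟨u, hu⟩ := exists_potential h
  have hmem := mem_criticalGraph_nodes_iff h hu
  rw [mem_criticalGraph_arcs_iff h hu] at hj hk
  obtain ⟨hij, p, hp⟩ := hj
  obtain ⟨hik, q, hq⟩ := hk
  obtain ⟨N₀, hN₀, hN₀Z⟩ := exists_common_period hu (Z := Set.univ) fun c _ => (hmem c).1 (hall c)
  set A' := normalize A u r with hA'
  have hstep : ∀ {a b : Fin n} {p : ℕ}, tpow A' p a i = 0 → A' i b = 0 →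
      tpow A' (p + 1) a b = 0 := by
    intro a b p h1 h2
    refine le_antisymm (tpow_nonpos hu _ _ _) ?_
    have := le_tmul (tpow A' p) A' a i b
    rwa [h1, h2, add_zero] at this
  -- A common multiple of the length `p + 1` of the passage from `j` to `k`, of the length `q + 1`
  -- of the way back, and of the period `N₀` of all nodes.
  set N := (p + 1) * (q + 1) * N₀ with hN
  have hjkN : tpow A' N j k = 0 := by
    rw [hN, mul_assoc]
    exact tpow_mul_eq_zero hu (hstep hp hij) (hstep hp hik) (Nat.mul_pos (by omega) hN₀)
  have hkjN : tpow A' N k j = 0 := by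
    rw [hN, mul_comm (p + 1), mul_assoc]
    exact tpow_mul_eq_zero hu (hstep hq hik) (hstep hq hij) (Nat.mul_pos (by omega) hN₀)
  set C := tpow A' N with hCdef
  have hC : ∀ i j, C i j ≤ 0 := tpow_nonpos hu N
  have hd : ∀ c, C c c = 0 := fun c => by
    rw [hCdef, hN, mul_comm]
    exact tpow_mul_diag hu (hN₀Z c trivial) _
  have hstab : tpow C (n + 1) = tpow C n := tpow_eq_of_diag hC hd (Nat.le_succ n)
  have hrow : ∀ {a b : Fin n}, C a b = 0 → ∀ l, tpow C n b l ≤ tpow C n a l := by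
    intro a b hab l
    have := le_tpow_add C 1 n a b l
    rwa [tpow_one, hab, zero_add, add_comm 1, hstab] at this
  have hcol : ∀ {a b : Fin n}, C a b = 0 → ∀ l, tpow C n l a ≤ tpow C n l b := by
    intro a b hab l
    have := le_tmul (tpow C n) C l a b
    rw [hab, add_zero] at this
    exact this.trans_eq (congrFun (congrFun hstab l) b)
  refine ⟨normalize (tpow C n) (-u) 0, ?_, ?_, ?_⟩
  · rw [hCdef, ← tpow_mul, proj_tpow_normalize]
    exact subset_closure ⟨N * n, rfl⟩
  · exact (hasDependentRow_of_eq hjk fun l =>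
      le_antisymm (hrow hkjN l) (hrow hjkN l)).normalize _ _
  · rw [transpose_normalize]
    exact (hasDependentRow_of_eq hjk fun l =>
      le_antisymm (hcol hjkN l) (hcol hkjN l)).normalize _ _

/-- A graph on all nodes, each with at least one arc in and exactly one arc out, is the graph of a
permutation. -/
theorem exists_eq_permGraph {n : ℕ} {G : DGraph n} (hall : ∀ i, i ∈ G.nodes)
    (hout : ∀ i, ∃ j, (i, j) ∈ G.arcs) (hin : ∀ i, ∃ j, (j, i) ∈ G.arcs)
    (huniq : ∀ i j k, (i, j) ∈ G.arcs → (i, k) ∈ G.arcs → j = k) :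
    ∃ τ, G = permGraph τ := by
  choose f hf using hout
  have hs : Function.Surjective f := fun i => by
    obtain ⟨j, hj⟩ := hin i
    exact ⟨j, huniq _ _ _ (hf j) hj⟩
  refine ⟨Equiv.ofBijective f (Finite.surjective_iff_bijective.1 hs), DGraph.ext ?_ ?_⟩
  · exact Set.eq_univ_of_forall hall
  · ext ⟨i, j⟩
    simp only [permGraph, Set.mem_range, Prod.mk.injEq, Equiv.ofBijective_apply]
    constructor
    · intro hij
      exact ⟨i, rfl, huniq _ _ _ (hf i) hij⟩
    · rintro ⟨i, rfl, rfl⟩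
      exact hf i

theorem urk_lt_of_dependent {n : ℕ} {A : TMat n n} (s : RankNotion)
    (h : ∃ B, proj B ∈ closProj A ∧ HasDependentRow B ∧ HasDependentRow B.transpose) :
    urk s A < n := by
  obtain ⟨B, hB, hr, hc⟩ := h
  exact lt_of_le_of_lt (Nat.sInf_le ⟨B, hB, rfl⟩) (rk_lt_of_dependent hr hc s)

theorem exists_criticalGraph_eq_permGraph {n : ℕ} {A : TMat n n} {s : RankNotion}
    (h : urk s A = n) : ∃ τ, criticalGraph A = permGraph τ := by
  rcases n.eq_zero_or_pos with rfl | hn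
  · exact exists_eq_permGraph (fun i => i.elim0) (fun i => i.elim0) (fun i => i.elim0)
      fun i => i.elim0
  have hno : ¬ ∃ B, proj B ∈ closProj A ∧ HasDependentRow B ∧ HasDependentRow B.transpose :=
    fun hB => (urk_lt_of_dependent s hB).ne h
  cases hr : rho A using WithBot.recBotCoe with
  | bot =>
    refine absurd ⟨nullMat n n, ?_, hasDependentRow_nullMat ⟨0, hn⟩,
      hasDependentRow_nullMat ⟨0, hn⟩⟩ hno
    rw [← tpow_eq_nullMat hr]
    exact subset_closure ⟨n, rfl⟩
  | coe r =>
    have hall : ∀ c, c ∈ (criticalGraph A).nodes := by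
      by_contra! hc
      obtain ⟨c, hc⟩ := hc
      exact hno (exists_dependent_of_not_critical hr hc)
    refine exists_eq_permGraph hall (fun i => (exists_arc_of_mem_nodes (hall i)).1)
      (fun i => (exists_arc_of_mem_nodes (hall i)).2) fun i j k hj hk => ?_
    by_contra hjk
    exact hno (exists_dependent_of_two_arcs hr hall hjk hj hk)

/-! ### The powers of a matrix whose critical graph is that of a permutation -/

theorem IsStrictMax.of_normalize {n : ℕ} {B : TMat n n} {u : Fin n → ℝ} {r : ℝ}
    {θ : Equiv.Perm (Fin n)} (h : IsStrictMax (normalize B u r) θ) : IsStrictMax B θ := by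
  simp only [IsStrictMax, permWeight_normalize] at h
  refine ⟨(WithBot.add_ne_bot.1 h.1).1, fun σ hσ => ?_⟩
  exact (WithBot.add_lt_add_iff_right WithBot.coe_ne_bot).1 (h.2 σ hσ)

theorem exists_rho_eq_coe {n : ℕ} {A : TMat n n} {τ : Equiv.Perm (Fin n)}
    (h : criticalGraph A = permGraph τ) (hn : 0 < n) : ∃ r : ℝ, rho A = r := by
  cases hr : rho A using WithBot.recBotCoe with
  | bot =>
    have h1 := criticalGraph_nodes_eq_empty hr
    rw [h] at h1
    have : (⟨0, hn⟩ : Fin n) ∈ (permGraph τ).nodes := trivial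
    rw [h1] at this
    exact absurd this (Set.notMem_empty _)
  | coe r => exact ⟨r, rfl⟩

theorem mem_permGraph_arcs {n : ℕ} {τ : Equiv.Perm (Fin n)} {i j : Fin n} :
    (i, j) ∈ (permGraph τ).arcs ↔ τ i = j := by
  simp only [permGraph, Set.mem_range, Prod.mk.injEq]
  constructor
  · rintro ⟨k, rfl, h⟩
    exact h
  · rintro h
    exact ⟨i, rfl, h⟩

/-- If all closed walks of weight `0` follow `τ`, then `τ ^ k` is strictly optimal in the `k`-th
power. -/
theorem isStrictMax_tpow {n : ℕ} {A : TMat n n} (hA : ∀ i j, A i j ≤ 0)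
    {τ : Equiv.Perm (Fin n)}
    (hτ : ∀ i j, τ i = j ↔ A i j = 0 ∧ ∃ m, tpow A m j i = 0) (k : ℕ) :
    IsStrictMax (tpow A k) (τ ^ k) := by
  have hzero : ∀ i, tpow A k i ((τ ^ k) i) = 0 := by
    intro i
    refine le_antisymm (tpow_nonpos hA _ _ _) ?_
    have h1 := walkWeight_le_tpow A (fun t => (τ ^ t) i) 0 k
    have h2 : walkWeight A (fun t => (τ ^ t) i) 0 (0 + k) = 0 := by
      refine sum_eq_zero fun t _ => ((hτ _ _).1 ?_).1
      simp only [pow_succ', Equiv.Perm.mul_apply]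
    rw [h2] at h1
    simpa using h1
  have hw : permWeight (tpow A k) (τ ^ k) = 0 := sum_eq_zero fun i _ => hzero i
  refine ⟨by rw [hw]; exact WithBot.coe_ne_bot, fun σ hσ => ?_⟩
  rw [hw]
  refine lt_of_le_of_ne (sum_nonpos fun i _ => tpow_nonpos hA _ _ _) fun h0 => hσ ?_
  rw [permWeight, sum_eq_zero_iff_of_nonpos fun i _ => tpow_nonpos hA _ _ _] at h0
  -- Iterating the rival `σ` provides the free return from `σ i` to `i` that closes up the walks.
  have hpow : ∀ (m : ℕ) (i : Fin n), tpow A (k * m) i ((σ ^ m) i) = 0 := by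
    intro m i
    refine le_antisymm (tpow_nonpos hA _ _ _) ?_
    induction m with
    | zero => simp [tpow_zero_diag]
    | succ m ih =>
      have h1 := le_tpow_add A (k * m) k i ((σ ^ m) i) ((σ ^ (m + 1)) i)
      have h2 := h0 ((σ ^ m) i) (mem_univ _)
      rw [← Equiv.Perm.mul_apply, ← pow_succ'] at h2
      rw [h2, add_zero] at h1
      exact ih.trans h1
  ext1 i
  have hi := h0 i (mem_univ i)
  obtain ⟨w, hw0, hwk, hww⟩ := exists_walk (by rw [hi]; exact WithBot.coe_ne_bot)
  have hwz := hww
  rw [hi, walkWeight, sum_eq_zero_iff_of_nonpos fun t _ => hA _ _] at hwz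
  have hseg : ∀ a b, a ≤ b → b ≤ k → tpow A (b - a) (w a) (w b) = 0 := by
    intro a b hab hb
    refine le_antisymm (tpow_nonpos hA _ _ _) ?_
    refine le_trans (le_of_eq ?_) (walkWeight_le_tpow_sub A w hab)
    refine (sum_eq_zero fun t ht => hwz t ?_).symm
    rw [mem_Ico] at ht ⊢
    omega
  obtain ⟨m, hm, hσm⟩ : ∃ m, 1 ≤ m ∧ σ ^ m = 1 :=
    ⟨orderOf σ, orderOf_pos σ, pow_orderOf_eq_one σ⟩
  have hback : tpow A (k * (m - 1)) (w k) (w 0) = 0 := by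
    have := hpow (m - 1) (σ i)
    rwa [← Equiv.Perm.mul_apply, ← pow_succ, Nat.sub_add_cancel hm, hσm, Equiv.Perm.one_apply,
      ← hwk, ← hw0] at this
  -- Each arc of the walk from `i` to `σ i` lies on a closed walk of weight `0`: finish the walk,
  -- follow the `σ`-orbit back to `i`, then go forward to time `t`.
  have hstep : ∀ t < k, w (t + 1) = τ (w t) := by
    intro t ht
    refine ((hτ _ _).2 ⟨hwz t (mem_Ico.2 ⟨Nat.zero_le t, ht⟩),
      k - (t + 1) + k * (m - 1) + (t - 0), ?_⟩).symm
    refine le_antisymm (tpow_nonpos hA _ _ _) ?_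
    have h1 := le_tpow_add A (k - (t + 1)) (k * (m - 1)) (w (t + 1)) (w k) (w 0)
    rw [hseg _ _ ht le_rfl, hback, add_zero] at h1
    refine le_trans ?_ (le_tpow_add A _ (t - 0) (w (t + 1)) (w 0) (w t))
    rw [hseg 0 t (Nat.zero_le t) ht.le, add_zero]
    exact h1
  have hwt : ∀ t ≤ k, w t = (τ ^ t) i := by
    intro t ht
    induction t with
    | zero => simpa using hw0
    | succ t ih => rw [hstep t ht, ih (by omega), pow_succ', Equiv.Perm.mul_apply]
  rw [← hwk, hwt k le_rfl]

theorem finite_range_of_periodic {α : Type*} {f : ℕ → α} {a N : ℕ} (hN : 0 < N)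
    (h : ∀ k, a ≤ k → f (k + N) = f k) : (Set.range f).Finite := by
  refine Set.Finite.subset ((Set.finite_Iio (a + N)).image f) ?_
  rintro _ ⟨k, rfl⟩
  induction k using Nat.strong_induction_on with
  | _ k ih =>
    by_cases hk : k < a + N
    · exact ⟨k, hk, rfl⟩
    · have e := h (k - N) (by omega)
      rw [Nat.sub_add_cancel (by omega)] at e
      rw [e]
      exact ih (k - N) (by omega)

/-- The `N`-th normalized power has zero diagonal, so its own powers stabilize at exponent `n`:
normalized powers are periodic with period `N` from `N * n` on. -/
theorem finite_range_proj_tpow {n : ℕ} {A : TMat n n} {u : Fin n → ℝ} {r : ℝ}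
    (hu : ∀ i j, normalize A u r i j ≤ 0)
    (hall : ∀ i, ∃ m, 1 ≤ m ∧ tpow (normalize A u r) m i i = 0) :
    (Set.range fun k : ℕ => proj (tpow A k)).Finite := by
  obtain ⟨N, hN, hNd⟩ := exists_common_period hu (Z := Set.univ) fun c _ => hall c
  have hstab := tpow_eq_of_diag (tpow_nonpos hu N) (fun c => hNd c trivial) (Nat.le_succ n)
  refine finite_range_of_periodic (a := N * n) hN fun k hk => ?_
  rw [← proj_tpow_normalize A u r, ← proj_tpow_normalize A u r k]
  congr 2
  obtain ⟨l, rfl⟩ := Nat.exists_eq_add_of_le hk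
  rw [add_right_comm, ← Nat.mul_succ, tpow_add, tpow_mul, hstab, ← tpow_mul, ← tpow_add]

theorem urk_eq_of_forall {n : ℕ} {A : TMat n n} {s : RankNotion}
    (h : ∀ B, proj B ∈ closProj A → rk s B = n) : urk s A = n := by
  have hmem : proj (tpow A 0) ∈ closProj A := subset_closure ⟨0, rfl⟩
  apply le_antisymm
  · exact Nat.sInf_le ⟨_, hmem, h _ hmem⟩
  · refine le_csInf ⟨n, _, hmem, h _ hmem⟩ ?_
    rintro _ ⟨B, hB, rfl⟩
    exact (h B hB).ge

theorem urk_eq_of_criticalGraph {n : ℕ} {A : TMat n n} {τ : Equiv.Perm (Fin n)}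
    (h : criticalGraph A = permGraph τ) (s : RankNotion) : urk s A = n := by
  refine urk_eq_of_forall fun B hB => ?_
  rcases n.eq_zero_or_pos with rfl | hn
  · have : IsStrictMax B 1 := ⟨by simp [permWeight], fun σ hσ => absurd (Subsingleton.elim _ _) hσ⟩
    exact this.rk_eq s
  obtain ⟨r, hr⟩ := exists_rho_eq_coe h hn
  obtain ⟨u, hu⟩ := exists_potential hr
  have hfin : (Set.range fun k : ℕ => proj (tpow A k)).Finite := by
    refine finite_range_proj_tpow hu fun i => ?_
    rw [← mem_criticalGraph_nodes_iff hr hu, h]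
    trivial
  rw [closProj, hfin.isClosed.closure_eq] at hB
  obtain ⟨k, hk⟩ := hB
  obtain ⟨c, hc⟩ := Quotient.exact (s := projSetoid n n) hk
  have hmax := isStrictMax_tpow hu (τ := τ) (fun i j => by
    rw [← mem_criticalGraph_arcs_iff hr hu, h, mem_permGraph_arcs]) k
  have he : tpow (normalize A u r) k = normalize B u (k * r + c) := by
    funext i j
    rw [tpow_normalize, normalize, hc, smulMat, add_right_comm, add_comm, ← WithBot.coe_add]
    congr 2
    ring
  rw [he] at hmax
  exact hmax.of_normalize.rk_eq s

theorem isStrictMax_of_criticalGraph {n : ℕ} {A : TMat n n} {τ : Equiv.Perm (Fin n)}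
    (h : criticalGraph A = permGraph τ) :
    IsStrictMax A τ ∧ permWeight A τ = n • rho A := by
  rcases n.eq_zero_or_pos with rfl | hn
  · exact ⟨⟨by simp [permWeight], fun σ hσ => absurd (Subsingleton.elim _ _) hσ⟩,
      by simp [permWeight]⟩
  obtain ⟨r, hr⟩ := exists_rho_eq_coe h hn
  obtain ⟨u, hu⟩ := exists_potential hr
  have harc : ∀ i j, τ i = j ↔ normalize A u r i j = 0 ∧
      ∃ m, tpow (normalize A u r) m j i = 0 := fun i j => by
    rw [← mem_criticalGraph_arcs_iff hr hu, h, mem_permGraph_arcs]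
  have hmax := isStrictMax_tpow hu harc 1
  rw [tpow_one, pow_one] at hmax
  refine ⟨hmax.of_normalize, ?_⟩
  have h0 : permWeight (normalize A u r) τ = 0 :=
    sum_eq_zero fun i _ => ((harc i (τ i)).1 rfl).1
  rw [permWeight_normalize, add_coe_eq_iff] at h0
  rw [h0, hr, ← WithBot.coe_nsmul]
  simp

/-! ### Disjoint unions of simple circuits and permutations -/

/-- Disjointness puts a node on a single circuit, and simplicity gives it a single position, hence a
single successor, there. -/
theorem exists_permGraph_of_disjointUnion {n : ℕ} {G : DGraph n}
    (h : IsDisjointUnionOfSimpleCircuits G) : ∃ τ, G = permGraph τ := by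
  obtain ⟨S, hsimple, hdisj, rfl, hall⟩ := h
  have hnode : ∀ i, ∃ c ∈ S, ∃ t, c.node t = i := by
    intro i
    have : i ∈ (unionGraph S).nodes := hall ▸ trivial
    simpa [unionGraph, ClosedSeq.graph] using this
  refine exists_eq_permGraph (fun i => hall ▸ trivial) (fun i => ?_) (fun i => ?_) ?_
  · obtain ⟨c, hc, t, rfl⟩ := hnode i
    exact ⟨_, Set.mem_biUnion hc ⟨t, rfl⟩⟩
  · obtain ⟨c, hc, t, rfl⟩ := hnode i
    exact ⟨c.node (t - 1), Set.mem_biUnion hc ⟨t - 1, by simp only [sub_add_cancel]⟩⟩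
  · intro i j k hj hk
    simp only [unionGraph, ClosedSeq.graph, Set.mem_iUnion, Set.mem_range, Prod.mk.injEq,
      exists_prop] at hj hk
    obtain ⟨c, hc, t, rfl, rfl⟩ := hj
    obtain ⟨d, hd, t', he, rfl⟩ := hk
    have hcd : c = d := by
      by_contra hne
      exact Set.disjoint_left.1 (hdisj hc hd hne) ⟨t, rfl⟩ ⟨t', he⟩
    subst hcd
    rw [hsimple c hc he]

/-- The cycle of a permutation through a node. -/
def cycleSeq {n : ℕ} (τ : Equiv.Perm (Fin n)) (i : Fin n) : ClosedSeq n :=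
  closedSeqOfWalk (fun t => τ^[t] i) (Function.minimalPeriod τ i - 1)

theorem cycleSeq_length {n : ℕ} (τ : Equiv.Perm (Fin n)) (i : Fin n) :
    (cycleSeq τ i).ℓ + 1 = Function.minimalPeriod τ i :=
  Nat.sub_add_cancel (Function.minimalPeriod_pos_of_mem_periodicPts
    (τ.injective.mem_periodicPts i))

theorem cycleSeq_node_succ {n : ℕ} (τ : Equiv.Perm (Fin n)) (i : Fin n)
    (t : Fin ((cycleSeq τ i).ℓ + 1)) :
    (cycleSeq τ i).node (t + 1) = τ ((cycleSeq τ i).node t) := by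
  have hw : τ^[Function.minimalPeriod τ i - 1 + 1] i = τ^[0] i := by
    have := cycleSeq_length τ i
    change Function.minimalPeriod τ i - 1 + 1 = _ at this
    rw [this]
    exact Function.iterate_minimalPeriod
  refine (closedSeqOfWalk_succ (w := fun t => τ^[t] i) hw t).trans ?_
  exact Function.iterate_succ_apply' τ t.1 i

theorem cycleSeq_isSimple {n : ℕ} (τ : Equiv.Perm (Fin n)) (i : Fin n) :
    (cycleSeq τ i).IsSimple := by
  intro s t hst
  have hs : s.1 < Function.minimalPeriod τ i := s.2.trans_eq (cycleSeq_length τ i)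
  have ht : t.1 < Function.minimalPeriod τ i := t.2.trans_eq (cycleSeq_length τ i)
  exact Fin.ext (Function.iterate_injOn_Iio_minimalPeriod hs ht hst)

theorem mem_cycleSeq_nodes {n : ℕ} (τ : Equiv.Perm (Fin n)) (i j : Fin n) :
    j ∈ (cycleSeq τ i).graph.nodes ↔ τ.SameCycle i j := by
  constructor
  · rintro ⟨t, rfl⟩
    refine ⟨(t.1 : ℤ), ?_⟩
    rw [zpow_natCast, Equiv.Perm.coe_pow]
    rfl
  · rintro h
    obtain ⟨k, -, rfl⟩ := h.exists_pow_eq'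
    have hlt : k % Function.minimalPeriod τ i < (cycleSeq τ i).ℓ + 1 := by
      rw [cycleSeq_length]
      refine Nat.mod_lt _ ?_
      rw [← cycleSeq_length]
      exact Nat.succ_pos _
    refine ⟨⟨_, hlt⟩, ?_⟩
    rw [Equiv.Perm.coe_pow]
    exact Function.iterate_mod_minimalPeriod_eq

theorem isDisjointUnion_permGraph {n : ℕ} (τ : Equiv.Perm (Fin n)) :
    IsDisjointUnionOfSimpleCircuits (permGraph τ) := by
  let R := Equiv.Perm.SameCycle.setoid τ
  -- One starting node per cycle: two rotations of the same cycle would be distinct closed sequences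
  -- sharing their nodes.
  let rep : Fin n → Fin n := fun i => (Quotient.mk R i).out
  have hrep : ∀ i, τ.SameCycle (rep i) i := fun i => Quotient.mk_out (s := R) i
  have hrep' : ∀ i j, τ.SameCycle i j → rep i = rep j := fun i j h =>
    congrArg Quotient.out (Quotient.sound (s := R) h)
  have hmem : ∀ i, i ∈ (cycleSeq τ (rep i)).graph.nodes := fun i =>
    (mem_cycleSeq_nodes τ _ _).2 (hrep i)
  refine ⟨Set.range fun i => cycleSeq τ (rep i), ?_, ?_, DGraph.ext ?_ ?_, rfl⟩
  · rintro _ ⟨i, rfl⟩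
    exact cycleSeq_isSimple τ _
  · rintro _ ⟨i, rfl⟩ _ ⟨j, rfl⟩ hne
    refine Set.disjoint_left.2 fun k hi hj => hne ?_
    rw [mem_cycleSeq_nodes] at hi hj
    have : rep i = rep j := hrep' i j
      (((hrep i).symm.trans hi).trans (hj.symm.trans (hrep j)))
    simp only [this]
  · refine (Set.eq_univ_of_forall fun i => ?_).symm
    exact Set.mem_biUnion ⟨i, rfl⟩ (hmem i)
  · ext ⟨i, j⟩
    rw [mem_permGraph_arcs]
    constructor
    · rintro rfl
      obtain ⟨t, ht⟩ := hmem i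
      refine Set.mem_biUnion ⟨i, rfl⟩ ⟨t, ?_⟩
      simp only [cycleSeq_node_succ, ht]
    · intro h
      simp only [unionGraph, ClosedSeq.graph, Set.mem_iUnion, Set.mem_range, Prod.mk.injEq,
        exists_prop] at h
      obtain ⟨_, ⟨k, rfl⟩, t, rfl, rfl⟩ := h
      exact (cycleSeq_node_succ τ _ t).symm

end Tropical53

end

open Tropical53
theorem corollary5p3 (n : ℕ) (A : TMat n n) (s : RankNotion) :
    List.TFAE
      [urk s A = n,
       IsDisjointUnionOfSimpleCircuits (criticalGraph A),
       ∃ τ : Equiv.Perm (Fin n), IsUniqueMaximizer A τ ∧ criticalGraph A = permGraph τ] ∧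
    (urk s A = n → per A = n • rho A) := by
  constructor
  · tfae_have 1 → 3 := fun h => by
      obtain ⟨τ, hτ⟩ := exists_criticalGraph_eq_permGraph h
      exact ⟨τ, (isStrictMax_of_criticalGraph hτ).1.isUniqueMaximizer, hτ⟩
    tfae_have 3 → 2 := fun ⟨τ, _, hτ⟩ => hτ ▸ isDisjointUnion_permGraph τ
    tfae_have 2 → 1 := fun h => by
      obtain ⟨τ, hτ⟩ := exists_permGraph_of_disjointUnion h
      exact urk_eq_of_criticalGraph hτ s
    tfae_finish
  · intro h
    obtain ⟨τ, hτ⟩ := exists_criticalGraph_eq_permGraph h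
    obtain ⟨hmax, hw⟩ := isStrictMax_of_criticalGraph hτ
    rw [hmax.per_eq, hw]
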